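/- Let $\mathbb{F}_q$ be a finite field with $q$ elements (of any characteristic) and let $E/\mathbb{F}_q$ be an elliptic curve given by a Weierstrass equation $y^2+a_1xy+a_3y=x^3+a_2x^2+a_4x+a_6$, with the double cover $\pi:E\to\mathbb{P}^1$, $(x,y)\mapsto x$. Put $a_q(E)=q+1-\#E(\mathbb{F}_q)$. For a closed point $y$ of $E$ over a closed point $x$ of $\mathbb{P}^1$ let $e(y\mid x)$ be the ramification index and $f(y\mid x)=[k(y):k(x)]$ the inertia degree. Call $x$ ramified if $e(y\mid x)>1$ for some $y\in\pi^{-1}(x)$; split if $e(y\mid x)=f(y\mid x)=1$ for all $y\in\pi^{-1}(x)$; and inert if $x$ is not ramified and $\pi^{-1}(x)$ is a single closed point. Let $\chi(x)=0,1,-1$ according as $x$ is ramified, split or inert, and extend $\chi$ multiplicatively to effective $0$-cycles, $\chi\left(\sum_x a_x x\right)=\prod_x\chi(x)^{a_x}$. Let $i_q(E)$ and $s_q(E)$ be the numbers of inert and of split points in $\mathbb{P}^1(\mathbb{F}_q)$, that is, among the closed points of degree $1$ of $\mathbb{P}^1$. Then all the sets counted or summed over here are finite, $$a_q(E)=-\sum_{x\in\mathbb{P}^1(\mathbb{F}_q)}\chi(x)=i_q(E)-s_q(E),$$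 and for every $n\ge 0$ $$\#\operatorname{Sym}^nE(\mathbb{F}_q)=\sum_{i+j=n}(q^i+\cdots+q+1)\sum_{\deg(\alpha)=j}\chi(\alpha),$$ where $\alpha$ runs over the effective $0$-cycles of degree $j$ on $\mathbb{P}^1$ (identified with the points of $\operatorname{Sym}^j\mathbb{P}^1(\mathbb{F}_q)$), and $\operatorname{Sym}^nE(\mathbb{F}_q)$ is the set of multisets of $n$ points of $E(\overline{\mathbb{F}}_q)$ that are stable under $\operatorname{Gal}(\overline{\mathbb{F}}_q/\mathbb{F}_q)$. -/

import Mathlib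

open scoped Classical Polynomial

noncomputable section

/-! ### Closed points of a smooth projective curve -/

/-- A closed point of the smooth projective curve over `k` with function field `K`: these points
correspond to the valuation rings of `K` that contain `k` and are different from `K`, a point `x`
being sent to its local ring. -/
structure ClosedPoint (k K : Type*) [Field k] [Field K] [Algebra k K] where
  /-- The local ring at the point. -/
  localRing : ValuationSubring K
  algebraMap_mem : ∀ c : k, algebraMap k K c ∈ localRing
  ne_top : localRing ≠ ⊤

namespace ClosedPoint

variable {k K L : Type*} [Field k] [Field K] [Field L] [Algebra k K] [Algebra k L] [Algebra K L]

/-- The local ring at a closed point is an algebra over the field of constants. -/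
instance (x : ClosedPoint k K) : Algebra k x.localRing :=
  ((algebraMap k K).codRestrict x.localRing.toSubring x.algebraMap_mem).toAlgebra

/-- The field of definition `k(x)` of a closed point. -/
abbrev residueField (x : ClosedPoint k K) : Type _ :=
  IsLocalRing.ResidueField x.localRing

/-- The degree `deg(x) = [k(x) : k]` of a closed point. -/
def degree (x : ClosedPoint k K) : ℕ :=
  Module.finrank k x.residueField

/-- For the morphism `π` of curves given by a field extension `L / K`: the relation `π(y) = x`,
that is, the local ring at `y` meets `K` in the local ring at `x`. -/
def LiesOver (y : ClosedPoint k L) (x : ClosedPoint k K) : Prop :=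
  y.localRing.comap (algebraMap K L) = x.localRing

/-- The homomorphism of local rings at `π(y) = x` and at `y`. -/
def LiesOver.localRingHom {y : ClosedPoint k L} {x : ClosedPoint k K} (h : y.LiesOver x) :
    x.localRing →+* y.localRing :=
  ((algebraMap K L).comp x.localRing.subtype).codRestrict y.localRing.toSubring (fun a => by
    have ha : (a : K) ∈ y.localRing.comap (algebraMap K L) := by
      rw [show y.localRing.comap (algebraMap K L) = x.localRing from h]
      exact a.2
    exact ha)

/-- The ramification index `e(y | x)`: the length of `𝒪_y / 𝔪_x 𝒪_y`. -/
def LiesOver.ramificationIdx {y : ClosedPoint k L} {x : ClosedPoint k K} (h : y.LiesOver x) : ℕ :=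
  letI := h.localRingHom.toAlgebra
  (IsLocalRing.maximalIdeal y.localRing).ramificationIdx x.localRing

/-- The inertia degree `f(y | x) = [k(y) : k(x)]`. -/
def LiesOver.inertiaDeg {y : ClosedPoint k L} {x : ClosedPoint k K} (h : y.LiesOver x) : ℕ :=
  letI := h.localRingHom.toAlgebra
  (IsLocalRing.maximalIdeal y.localRing).inertiaDeg x.localRing

variable (L) in
/-- `x` is ramified: `e(y | x) > 1` for some `y` in the fibre over `x`. -/
def IsRamified (x : ClosedPoint k K) : Prop :=
  ∃ (y : ClosedPoint k L) (h : y.LiesOver x), 1 < h.ramificationIdx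

variable (L) in
/-- `x` is split: `e(y | x) = f(y | x) = 1` for all `y` in the fibre over `x`. -/
def IsSplit (x : ClosedPoint k K) : Prop :=
  ∀ (y : ClosedPoint k L) (h : y.LiesOver x), h.ramificationIdx = 1 ∧ h.inertiaDeg = 1

variable (L) in
/-- `x` is inert: it is not ramified and the fibre over `x` is a single closed point. -/
def IsInert (x : ClosedPoint k K) : Prop :=
  ¬ x.IsRamified L ∧ ∃! y : ClosedPoint k L, y.LiesOver x

variable (L) in
/-- The character of a double cover: `0` on ramified, `1` on split, `-1` on inert points. -/
def chi (x : ClosedPoint k K) : ℤ :=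
  if x.IsRamified L then 0 else if x.IsSplit L then 1 else if x.IsInert L then -1 else 0

end ClosedPoint

/-! ### Effective zero-cycles -/

/-- Effective `0`-cycles: formal sums `∑ aₓ x` of closed points with coefficients in `ℕ`. -/
abbrev EffectiveCycle (k K : Type*) [Field k] [Field K] [Algebra k K] : Type _ :=
  ClosedPoint k K →₀ ℕ

namespace EffectiveCycle

variable {k K : Type*} (L : Type*) [Field k] [Field K] [Field L] [Algebra k K] [Algebra k L]
  [Algebra K L]

/-- `deg (∑ aₓ x) = ∑ aₓ deg(x)`. -/
def degree (α : EffectiveCycle k K) : ℕ :=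
  α.sum fun x a => a * x.degree

/-- The multiplicative extension `χ(∑ aₓ x) = ∏ χ(x) ^ aₓ`. -/
def chi (α : EffectiveCycle k K) : ℤ :=
  α.prod fun x a => x.chi L ^ a

end EffectiveCycle

/-! ### The double cover of the projective line by an elliptic curve -/

namespace WeierstrassCurve

variable {F : Type*} [Field F] (W : WeierstrassCurve F)

/-- The inclusion of function fields `F(x) ⊆ F(W)` given by the projection `(x, y) ↦ x`. -/
instance : Algebra (RatFunc F) W.toAffine.FunctionField :=
  RatFunc.liftAlgebra F W.toAffine.FunctionField

/-- The trace `a_q = q + 1 - #W(F)` of a Weierstrass curve over a field `F` with `q` elements. -/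
def aq : ℤ := Nat.card F + 1 - Nat.card W.toAffine.Point

/-- The number `s_q` of split `F`-points of the projective line. -/
def splitCount : ℕ :=
  {x : ClosedPoint F (RatFunc F) | x.degree = 1 ∧ x.IsSplit W.toAffine.FunctionField}.ncard

/-- The number `i_q` of inert `F`-points of the projective line. -/
def inertCount : ℕ :=
  {x : ClosedPoint F (RatFunc F) | x.degree = 1 ∧ x.IsInert W.toAffine.FunctionField}.ncard

/-- The `F`-points of the `n`-th symmetric power of `W`, for a perfect field `F`: the multisets of
`n` points of `W` over the algebraic closure of `F` that are fixed by the absolute Galois group. -/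
abbrev SymPoint (n : ℕ) : Type _ :=
  {s : Sym (W.baseChange (AlgebraicClosure F)).toAffine.Point n //
    ∀ σ : AlgebraicClosure F ≃ₐ[F] AlgebraicClosure F,
      s.map (Affine.Point.map (W' := W.toAffine) σ.toAlgHom) = s}

end WeierstrassCurve

end

/-! The formula for the symmetric powers is the factorisation Z(E,T) = Z(P^1,T) L(χ,T) read
coefficient by coefficient. A stable multiset of geometric points is a formal sum of Galois orbits
(`symStableEquiv`), so the number of F-points of Sym^n E is the coefficient of T^n in the product of
1/(1 - T^|o|) over the orbits o. The orbits above a closed point x of degree d are one of size d if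
x is ramified, two of size d if x is split, one of size 2d if x is inert. In every case their
factors multiply to 1/(1 - T^d) · 1/(1 - χ(x)T^d) (`exists_finset_orbits`). The product of the first
factors counts effective cycles on P^1: those of degree i correspond to monic polynomials of degree
at most i, the point at infinity supplying the missing degree, which gives 1 + q + ... + q^i
(`card_degree_eq`). The product of the second factors gives the sums of χ(α).

The main work is to match χ, defined through valuation rings of function fields, with orbits, made
of coordinates. Both are read off the Weierstrass equation y² + sy + t = 0, with s = `yCoeff` and t
= `oneCoeff`, modulo the monic irreducible polynomial p of an affine point x: it has a double root,
a simple root or no root in F[X]/(p) (`dvd_trichotomy`). If r is a root, y - r satisfies a quadratic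
with linear coefficient 2r + s and constant term `subst r`. For a double root, smoothness forbids p²
∣ `subst r`, so this quadratic is Eisenstein and x is ramified. For a simple root neither value
group nor residue field grows, so x is split. With no root the residue field grows and x is inert.
At infinity y/x² has an Eisenstein equation. No square is completed, so all characteristics are
treated alike. On the geometric side a root r gives the graphs of r and of -s - r over the zeros of
p: each is one orbit, and the two are equal or disjoint. With no root, Galois theory fuses the fibre
into one orbit.

For the trace, 1 + χ rational points lie over each x = a, and one point lies over infinity, where χ
= 0. -/

noncomputable section

/-! ### Discrete valuation rings and their extension to an overfield. -/

namespace ValuationSubring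

variable {K : Type*} [Field K]

/-- `π` is a uniformizer of the valuation ring `A`: it is a nonzero nonunit and its powers exhaust
the value group. -/
structure IsUniformizer (A : ValuationSubring K) (π : K) : Prop where
  ne_zero : π ≠ 0
  lt_one : A.valuation π < 1
  exists_zpow : ∀ z : K, z ≠ 0 → ∃ n : ℤ, A.valuation z = A.valuation π ^ n

namespace IsUniformizer

variable {A : ValuationSubring K} {π : K}

theorem val_pos (h : A.IsUniformizer π) : 0 < A.valuation π :=
  zero_lt_iff.2 ((Valuation.ne_zero_iff _).2 h.ne_zero)

theorem exists_pow (h : A.IsUniformizer π) {z : K} (hz : z ≠ 0) (hz1 : A.valuation z ≤ 1) :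
    ∃ n : ℕ, A.valuation z = A.valuation π ^ n := by
  obtain ⟨n, hn⟩ := h.exists_zpow z hz
  obtain ⟨m, rfl | rfl⟩ := n.eq_nat_or_neg
  · exact ⟨m, by simpa using hn⟩
  · rcases Nat.eq_zero_or_pos m with rfl | hm
    · exact ⟨0, by simpa using hn⟩
    · exfalso
      rw [hn, zpow_neg, zpow_natCast, inv_le_one₀ (pow_pos h.val_pos m)] at hz1
      exact absurd (pow_lt_one₀ zero_le h.lt_one hm.ne') (not_lt.2 hz1)

theorem val_le_of_lt_one (h : A.IsUniformizer π) {z : K} (hz : A.valuation z < 1) :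
    A.valuation z ≤ A.valuation π := by
  rcases eq_or_ne z 0 with rfl | h0
  · simp
  obtain ⟨n, hn⟩ := h.exists_pow h0 hz.le
  rcases Nat.eq_zero_or_pos n with rfl | hn0
  · simp [hn] at hz
  · rw [hn]
    exact pow_le_of_le_one zero_le h.lt_one.le hn0.ne'

theorem mem (h : A.IsUniformizer π) : π ∈ A := (A.valuation_le_one_iff π).1 h.lt_one.le

theorem maximalIdeal_eq (h : A.IsUniformizer π) :
    IsLocalRing.maximalIdeal A = Ideal.span {⟨π, h.mem⟩} := by
  ext z
  rw [A.valuation_lt_one_iff, Ideal.mem_span_singleton']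
  constructor
  · intro hz
    have := (A.valuation_le_iff (z : K) π).1 (h.val_le_of_lt_one hz)
    obtain ⟨a, ha⟩ := this
    exact ⟨a, Subtype.ext ha⟩
  · rintro ⟨a, rfl⟩
    calc A.valuation ((a * ⟨π, h.mem⟩ : A) : K) = A.valuation a * A.valuation π := by simp
      _ ≤ 1 * A.valuation π := mul_le_mul_left (A.valuation_le_one a) _
      _ < 1 := by simpa using h.lt_one

/-- A product of two nonunits has value at most v(π)² < v(π), so π is irreducible; every nonzero
element is a unit times a power of π. -/
theorem isDiscreteValuationRing (h : A.IsUniformizer π) : IsDiscreteValuationRing A := by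
  refine IsDiscreteValuationRing.ofHasUnitMulPowIrreducibleFactorization
    ⟨⟨π, h.mem⟩, ⟨fun hu => ?_, fun a b hab => ?_⟩, fun {x} hx => ?_⟩
  · exact h.lt_one.ne ((A.valuation_eq_one_iff ⟨π, h.mem⟩).1 hu)
  · by_contra! hcon
    have ha : A.valuation (a : K) < 1 :=
      (A.valuation_lt_one_or_eq_one a).resolve_right
        fun e => hcon.1 ((A.valuation_eq_one_iff a).2 e)
    have hb : A.valuation (b : K) < 1 :=
      (A.valuation_lt_one_or_eq_one b).resolve_right
        fun e => hcon.2 ((A.valuation_eq_one_iff b).2 e)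
    have h1 : A.valuation π = A.valuation a * A.valuation b := by
      rw [← map_mul]; exact congrArg _ (congrArg Subtype.val hab)
    have h2 : A.valuation a * A.valuation b < A.valuation π * 1 :=
      mul_lt_mul_of_le_of_lt_of_nonneg_of_pos (h.val_le_of_lt_one ha) hb zero_le h.val_pos
    rw [← h1, mul_one] at h2
    exact h2.false
  · obtain ⟨n, hn⟩ := h.exists_pow (fun e => hx (Subtype.ext e)) (A.valuation_le_one x)
    refine ⟨n, ?_⟩
    obtain ⟨u, hu⟩ := (A.valuation_eq_iff (x : K) (π ^ n)).1 (by rw [hn, map_pow])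
    refine ⟨u, Subtype.ext ?_⟩
    rw [mul_comm, ← hu]
    simp

/-- A discrete valuation ring is maximal among proper subrings of its field, so an inclusion of
local rings already identifies two closed points. -/
theorem eq_of_le (h : A.IsUniformizer π) {B : ValuationSubring K} (hAB : A ≤ B) (hB : B ≠ ⊤) :
    A = B := by
  have := h.isDiscreteValuationRing
  exact eq_of_le_of_ne_top A hAB hB

end IsUniformizer

theorem valuation_lt_one_iff_inv_notMem (A : ValuationSubring K) {z : K} (hz : z ≠ 0) :
    A.valuation z < 1 ↔ z⁻¹ ∉ A := by
  rw [← A.valuation_le_one_iff, map_inv₀,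
    inv_le_one₀ (zero_lt_iff.2 ((Valuation.ne_zero_iff _).2 hz)), not_le]

section Comap

variable {L : Type*} [Field L] {A : ValuationSubring K} {B : ValuationSubring L} {f : K →+* L}

theorem valuation_le_one_of_comap_eq (h : B.comap f = A) (z : K) :
    B.valuation (f z) ≤ 1 ↔ A.valuation z ≤ 1 := by
  subst h
  rw [valuation_le_one_iff, valuation_le_one_iff, mem_comap]

theorem valuation_lt_one_of_comap_eq (h : B.comap f = A) (z : K) :
    B.valuation (f z) < 1 ↔ A.valuation z < 1 := by
  rcases eq_or_ne z 0 with rfl | hz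
  · simp
  rw [valuation_lt_one_iff_inv_notMem _ hz,
    valuation_lt_one_iff_inv_notMem _ ((map_ne_zero f).2 hz), ← map_inv₀]
  subst h
  rw [mem_comap]

theorem valuation_eq_one_of_comap_eq (h : B.comap f = A) (z : K) :
    B.valuation (f z) = 1 ↔ A.valuation z = 1 := by
  rw [eq_iff_le_not_lt, eq_iff_le_not_lt, valuation_le_one_of_comap_eq h,
    valuation_lt_one_of_comap_eq h]

theorem valuation_lt_of_comap_eq (h : B.comap f = A) (z z' : K) :
    B.valuation (f z) < B.valuation (f z') ↔ A.valuation z < A.valuation z' := by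
  rcases eq_or_ne z' 0 with rfl | hz
  · simp
  rw [← div_lt_one₀ (zero_lt_iff.2 ((Valuation.ne_zero_iff A.valuation).2 hz)),
   ← div_lt_one₀ (zero_lt_iff.2 ((Valuation.ne_zero_iff B.valuation).2 ((map_ne_zero f).2 hz))),
   ← map_div₀, ← map_div₀, ← map_div₀, valuation_lt_one_of_comap_eq h]

theorem valuation_eq_of_comap_eq (h : B.comap f = A) (z z' : K) :
    B.valuation (f z) = B.valuation (f z') ↔ A.valuation z = A.valuation z' := by
  have h1 := valuation_lt_of_comap_eq h z z'
  have h2 := valuation_lt_of_comap_eq h z' z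
  constructor
  · intro e
    exact le_antisymm (not_lt.1 fun h' => (h2.2 h').ne' e) (not_lt.1 fun h' => (h1.2 h').ne e)
  · intro e
    exact le_antisymm (not_lt.1 fun h' => (h2.1 h').ne' e) (not_lt.1 fun h' => (h1.1 h').ne e)

/-- Every valuation ring with a nontrivial value extends to an overfield. -/
theorem exists_comap_eq {π : K} (hA : A.IsUniformizer π) (f : K →+* L) :
    ∃ B : ValuationSubring L, B.comap f = A := by
  let R : Subring L := A.toSubring.map f
  let e : A.toSubring ≃+* R := A.toSubring.equivMapOfInjective f f.injective
  have hI : (IsLocalRing.maximalIdeal A).map (e : A →+* R) ≠ ⊤ := by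
    have : ((IsLocalRing.maximalIdeal A).map (e : A →+* R)).comap (e : A →+* R) =
        IsLocalRing.maximalIdeal A :=
      Ideal.comap_map_of_bijective _ e.bijective
    intro h
    rw [h, Ideal.comap_top] at this
    exact (IsLocalRing.maximalIdeal.isMaximal A).ne_top this.symm
  -- Chevalley: some valuation ring of L contains the image of A and has the image of its maximal
  -- ideal among its nonunits. Its trace on K contains A, and is proper because π stays a nonunit.
  obtain ⟨B, hB1, hB2⟩ := Ideal.image_subset_nonunits_valuationSubring _ hI
  refine ⟨B, (hA.eq_of_le (fun z hz => ?_) fun htop => ?_).symm⟩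
  · exact hB1 (Subring.mem_map.2 ⟨z, hz, rfl⟩)
  · have h1 : f π ∈ B.nonunits := by
      apply hB2
      refine ⟨e ⟨π, hA.mem⟩, Ideal.mem_map_of_mem _ ?_, rfl⟩
      exact (A.valuation_lt_one_iff ⟨π, hA.mem⟩).2 hA.lt_one
    have h2 : π⁻¹ ∈ B.comap f := htop ▸ mem_top _
    rw [mem_comap, map_inv₀] at h2
    rw [mem_nonunits_iff_exists_mem_maximalIdeal] at h1
    obtain ⟨h3, h4⟩ := h1
    rw [valuation_lt_one_iff] at h4
    exact (valuation_lt_one_iff_inv_notMem B ((map_ne_zero f).2 hA.ne_zero)).1 h4 h2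

end Comap

end ValuationSubring

/-! ### Ramification index and inertia degree in terms of valuations. -/

namespace ClosedPoint.LiesOver

open ValuationSubring

variable {k K L : Type*} [Field k] [Field K] [Field L] [Algebra k K] [Algebra k L] [Algebra K L]
  {x : ClosedPoint k K} {y : ClosedPoint k L}

theorem maximalIdeal_liesOver (h : y.LiesOver x) :
    letI := h.localRingHom.toAlgebra
    (IsLocalRing.maximalIdeal y.localRing).LiesOver (IsLocalRing.maximalIdeal x.localRing) := by
  let := h.localRingHom.toAlgebra
  refine ⟨?_⟩
  ext a
  rw [Ideal.mem_comap, ValuationSubring.valuation_lt_one_iff,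
    ValuationSubring.valuation_lt_one_iff]
  exact (valuation_lt_one_of_comap_eq h (a : K)).symm

theorem ramificationIdx_eq (h : y.LiesOver x) {p : K} {π : L} {e : ℕ}
    (hp : x.localRing.IsUniformizer p) (hπ : y.localRing.IsUniformizer π)
    (he : y.localRing.valuation (algebraMap K L p) = y.localRing.valuation π ^ e) :
    h.ramificationIdx = e := by
  let := h.localRingHom.toAlgebra
  have := h.maximalIdeal_liesOver
  have := hπ.isDiscreteValuationRing
  have hmap : (IsLocalRing.maximalIdeal x.localRing).map (algebraMap x.localRing y.localRing) =
      IsLocalRing.maximalIdeal y.localRing ^ e := by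
    rw [hp.maximalIdeal_eq, hπ.maximalIdeal_eq, Ideal.map_span, Ideal.span_singleton_pow,
      Set.image_singleton, Ideal.span_singleton_eq_span_singleton]
    obtain ⟨u, hu⟩ := (y.localRing.valuation_eq_iff (algebraMap K L p) (π ^ e)).1
      (by rw [he, map_pow])
    refine Associated.symm ⟨u, Subtype.ext ?_⟩
    rw [mul_comm]
    exact hu
  have h0 : IsLocalRing.maximalIdeal y.localRing ≠ ⊥ := by
    rw [hπ.maximalIdeal_eq, Ne, Ideal.span_singleton_eq_bot]
    exact fun e => hπ.ne_zero (congrArg Subtype.val e)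
  have hb : IsLocalRing.maximalIdeal y.localRing ^ e ≠ ⊥ := pow_ne_zero e h0
  change (IsLocalRing.maximalIdeal y.localRing).ramificationIdx x.localRing = e
  rw [← Ideal.ramificationIdx'_eq_ramificationIdx' (IsLocalRing.maximalIdeal x.localRing)
    (IsLocalRing.maximalIdeal y.localRing) (hmap ▸ hb)]
  refine Ideal.ramificationIdx'_spec hmap.le ?_
  rw [hmap]
  intro hle
  exact (Ideal.pow_right_strictAnti _ h0 (IsLocalRing.maximalIdeal.isMaximal _).ne_top
    (Nat.lt_succ_self e)).not_ge hle

/-- The residue extension has degree one exactly when the class of 1 spans it, that is, when every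
residue class at y has a representative from the local ring at x. -/
theorem inertiaDeg_eq_one_iff (h : y.LiesOver x) :
    h.inertiaDeg = 1 ↔ ∀ z ∈ y.localRing, ∃ c ∈ x.localRing,
      y.localRing.valuation (z - algebraMap K L c) < 1 := by
  let := h.localRingHom.toAlgebra
  have := h.maximalIdeal_liesOver
  change (IsLocalRing.maximalIdeal y.localRing).inertiaDeg x.localRing = 1 ↔ _
  rw [Ideal.inertiaDeg_eq_of_isMaximal (IsLocalRing.maximalIdeal x.localRing)]
  let : Field (x.localRing ⧸ IsLocalRing.maximalIdeal x.localRing) := Ideal.Quotient.field _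
  let : Field (y.localRing ⧸ IsLocalRing.maximalIdeal y.localRing) := Ideal.Quotient.field _
  rw [finrank_eq_one_iff_of_nonzero' (1 : y.localRing ⧸ IsLocalRing.maximalIdeal y.localRing)
    one_ne_zero]
  have key : ∀ (z : y.localRing) (c : x.localRing),
      (Ideal.Quotient.mk (IsLocalRing.maximalIdeal x.localRing) c •
        (1 : y.localRing ⧸ IsLocalRing.maximalIdeal y.localRing) =
        Ideal.Quotient.mk (IsLocalRing.maximalIdeal y.localRing) z) ↔
      y.localRing.valuation ((z : L) - algebraMap K L c) < 1 := by
    intro z c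
    rw [Algebra.smul_def, mul_one, Ideal.Quotient.algebraMap_mk_of_liesOver, eq_comm,
      Ideal.Quotient.eq, ValuationSubring.valuation_lt_one_iff]
    rfl
  constructor
  · intro H z hz
    obtain ⟨c, hc⟩ := H (Ideal.Quotient.mk _ ⟨z, hz⟩)
    obtain ⟨c, rfl⟩ := Ideal.Quotient.mk_surjective c
    exact ⟨c, c.2, (key ⟨z, hz⟩ c).1 hc⟩
  · intro H w
    obtain ⟨w, rfl⟩ := Ideal.Quotient.mk_surjective w
    obtain ⟨c, hc, hcw⟩ := H w w.2
    exact ⟨Ideal.Quotient.mk _ ⟨c, hc⟩, (key w ⟨c, hc⟩).2 hcw⟩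

end ClosedPoint.LiesOver
end

/-! ### Valuations on a quadratic extension. -/

noncomputable section

/-- `w` generates the quadratic extension `L / K` and is a root of `X ^ 2 + s X + t`. -/
structure IsQuadraticGenerator {K L : Type*} [Field K] [Field L] [Algebra K L] (w : L) (s t : K) :
    Prop where
  sq_add_mul_add : w ^ 2 + algebraMap K L s * w + algebraMap K L t = 0
  algebraMap_ne : ∀ c : K, algebraMap K L c ≠ w

namespace IsQuadraticGenerator

variable {K L : Type*} [Field K] [Field L] [Algebra K L] {w : L} {s t : K}

/-- Taylor expansion at r: the new coefficients are the derivative and the value at r of the old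
quadratic, so a root modulo the maximal ideal is moved to 0. -/
theorem sub_algebraMap (h : IsQuadraticGenerator w s t) (r : K) :
    IsQuadraticGenerator (w - algebraMap K L r) (2 * r + s) (r ^ 2 + s * r + t) := by
  refine ⟨?_, fun c hc => h.algebraMap_ne (c + r) ?_⟩
  · have := h.sq_add_mul_add
    simp only [map_add, map_mul, map_pow, map_ofNat]
    linear_combination this
  · rw [map_add, hc, sub_add_cancel]

theorem algebraMap_mul (h : IsQuadraticGenerator w s t) {u : K} (hu : u ≠ 0) :
    IsQuadraticGenerator (algebraMap K L u * w) (u * s) (u ^ 2 * t) := by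
  refine ⟨?_, fun c hc => h.algebraMap_ne (c / u) ?_⟩
  · have := h.sq_add_mul_add
    simp only [map_mul, map_pow]
    linear_combination algebraMap K L u ^ 2 * this
  · rw [map_div₀, hc, mul_div_cancel_left₀ _ ((map_ne_zero _).2 hu)]

theorem conj (h : IsQuadraticGenerator w s t) :
    IsQuadraticGenerator (-algebraMap K L s - w) s t := by
  refine ⟨?_, fun c hc => h.algebraMap_ne (-s - c) ?_⟩
  · linear_combination h.sq_add_mul_add
  · rw [map_sub, map_neg, hc]; ring

theorem exists_eq_add_mul [Algebra.IsQuadraticExtension K L] (h : IsQuadraticGenerator w s t)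
    (z : L) : ∃ c d : K, z = algebraMap K L c + algebraMap K L d * w := by
  have hli : LinearIndependent K ![1, w] := by
    rw [LinearIndependent.pair_iff' one_ne_zero]
    intro a ha
    exact h.algebraMap_ne a (by rw [← ha, Algebra.smul_def, mul_one])
  have hspan := hli.span_eq_top_of_card_eq_finrank
    (by rw [Algebra.IsQuadraticExtension.finrank_eq_two]; simp)
  have hz : z ∈ Submodule.span K (Set.range ![1, w]) := hspan ▸ Submodule.mem_top
  rw [Matrix.range_cons, Matrix.range_cons, Matrix.range_empty, Set.union_empty,
    Set.singleton_union, Submodule.mem_span_pair] at hz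
  obtain ⟨c, d, hcd⟩ := hz
  exact ⟨c, d, by rw [← hcd, Algebra.smul_def, Algebra.smul_def, mul_one]⟩

theorem exists_algEquiv [Algebra.IsQuadraticExtension K L] (h : IsQuadraticGenerator w s t) :
    ∃ σ : L ≃ₐ[K] L, σ w = -algebraMap K L s - w := by
  let P : K[X] := Polynomial.X ^ 2 + Polynomial.C s * Polynomial.X + Polynomial.C t
  have hP : P.Monic := by simp only [P]; monicity!
  have hdeg : P.natDegree = 2 := by simp only [P]; compute_degree!
  have hint : IsIntegral K w := Algebra.IsIntegral.isIntegral w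
  have hmin : minpoly K w = P := by
    refine (Polynomial.eq_of_monic_of_dvd_of_natDegree_le (minpoly.monic hint) hP
      (minpoly.dvd K w ?_) ?_).symm
    · simpa [P] using h.sq_add_mul_add
    · rw [hdeg, minpoly.two_le_natDegree_iff hint]
      rintro ⟨c, hc⟩
      exact h.algebraMap_ne c hc
  refine minpoly.exists_algEquiv_of_root' hint.isAlgebraic ?_
  rw [hmin]
  simpa [P] using h.conj.sq_add_mul_add

section Valuation

open ValuationSubring

variable {A : ValuationSubring K} {B : ValuationSubring L} {p : K}

theorem mem_of_mem (h : IsQuadraticGenerator w s t) (hB : B.comap (algebraMap K L) = A)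
    (hs : s ∈ A) (ht : t ∈ A) : w ∈ B := by
  rw [← valuation_le_one_iff] at hs ht ⊢
  rw [← valuation_le_one_of_comap_eq hB] at hs ht
  by_contra! hw
  have h1 : w ^ 2 = -(algebraMap K L s * w + algebraMap K L t) := by
    linear_combination h.sq_add_mul_add
  have h2 : B.valuation (w ^ 2) ≤ B.valuation w := by
    rw [h1, Valuation.map_neg]
    refine (Valuation.map_add _ _ _).trans (max_le ?_ (ht.trans hw.le))
    rw [map_mul]
    exact mul_le_of_le_one_left (zero_le) hs
  rw [map_pow] at h2
  exact absurd h2 (not_le.2 (lt_self_pow₀ hw one_lt_two))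

/-- The Eisenstein case: w must have value below 1, so s w is strictly smaller than t and w² has the
value of t. -/
theorem valuation_sq_eq (h : IsQuadraticGenerator w s t) (hB : B.comap (algebraMap K L) = A)
    (hp : A.IsUniformizer p) (hs : A.valuation s < 1) (ht : A.valuation t = A.valuation p) :
    B.valuation (algebraMap K L p) = B.valuation w ^ 2 := by
  have hsp : B.valuation (algebraMap K L s) ≤ B.valuation (algebraMap K L p) := by
    rw [← not_lt, valuation_lt_of_comap_eq hB, not_lt]
    exact hp.val_le_of_lt_one hs
  rw [← valuation_eq_of_comap_eq hB] at ht
  have hp1 : B.valuation (algebraMap K L p) < 1 :=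
    (valuation_lt_one_of_comap_eq hB p).2 hp.lt_one
  have hp0 : 0 < B.valuation (algebraMap K L p) :=
    zero_lt_iff.2 ((Valuation.ne_zero_iff _).2 ((map_ne_zero _).2 hp.ne_zero))
  have hw : B.valuation w < 1 := by
    by_contra! hw
    have h1 : w ^ 2 = -(algebraMap K L s * w + algebraMap K L t) := by
      linear_combination h.sq_add_mul_add
    have h2 : B.valuation (w ^ 2) < B.valuation w := by
      rw [h1, Valuation.map_neg]
      refine (Valuation.map_add _ _ _).trans_lt (max_lt ?_ ((ht.trans_lt hp1).trans_le hw))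
      rw [map_mul]
      exact mul_lt_of_lt_one_left (zero_lt_one.trans_le hw) (hsp.trans_lt hp1)
    rw [map_pow] at h2
    exact absurd h2 (not_lt.2 (le_self_pow₀ hw two_ne_zero))
  have h1 : algebraMap K L t = -(w ^ 2) + -(algebraMap K L s * w) := by
    linear_combination h.sq_add_mul_add
  have h3 : B.valuation (-(algebraMap K L s * w)) < B.valuation (algebraMap K L t) := by
    rw [Valuation.map_neg, map_mul, ht]
    exact (mul_le_mul_left hsp _).trans_lt (mul_lt_of_lt_one_right hp0 hw)
  have h4 : -(w ^ 2) = algebraMap K L t - -(algebraMap K L s * w) := by rw [h1]; ring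
  rw [← map_pow, ← Valuation.map_neg _ (w ^ 2), h4, Valuation.map_sub_eq_of_lt_left _ h3, ht]

/-- Elements of K have values that are even powers of v(w), and elements of K w odd powers. So the
two terms of c + d w never cancel and every value is a power of v(w). -/
theorem isUniformizer_of_ramified [Algebra.IsQuadraticExtension K L]
    (h : IsQuadraticGenerator w s t) (hB : B.comap (algebraMap K L) = A)
    (hp : A.IsUniformizer p) (hs : A.valuation s < 1) (ht : A.valuation t = A.valuation p) :
    B.IsUniformizer w := by
  have hsq := h.valuation_sq_eq hB hp hs ht
  have hw0 : w ≠ 0 := fun e => h.algebraMap_ne 0 (by rw [e, map_zero])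
  have hv0 : B.valuation w ≠ 0 := (Valuation.ne_zero_iff _).2 hw0
  have hw1 : B.valuation w < 1 := by
    by_contra! hw
    have := (valuation_lt_one_of_comap_eq hB p).2 hp.lt_one
    rw [hsq] at this
    exact absurd (one_le_pow₀ hw (n := 2)) (not_le.2 this)
  have hK : ∀ c : K, c ≠ 0 → ∃ n : ℤ, B.valuation (algebraMap K L c) = B.valuation w ^ (2 * n) := by
    intro c hc
    obtain ⟨n, hn⟩ := hp.exists_zpow c hc
    refine ⟨n, ?_⟩
    rw [← map_zpow₀, ← valuation_eq_of_comap_eq hB, map_zpow₀, map_zpow₀, hsq] at hn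
    rw [hn, zpow_mul]
    rfl
  refine ⟨hw0, hw1, fun z hz => ?_⟩
  obtain ⟨c, d, rfl⟩ := h.exists_eq_add_mul z
  rcases eq_or_ne d 0 with rfl | hd
  · obtain ⟨n, hn⟩ := hK c (by rintro rfl; simp at hz)
    exact ⟨2 * n, by simpa using hn⟩
  obtain ⟨m, hm⟩ := hK d hd
  have hdw : B.valuation (algebraMap K L d * w) = B.valuation w ^ (2 * m + 1) := by
    rw [map_mul, hm, zpow_add_one₀ hv0]
  rcases eq_or_ne c 0 with rfl | hc
  · exact ⟨2 * m + 1, by rw [map_zero, zero_add, hdw]⟩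
  obtain ⟨n, hn⟩ := hK c hc
  have hne : B.valuation (algebraMap K L c) ≠ B.valuation (algebraMap K L d * w) := by
    rw [hn, hdw]
    intro e
    have := (zpow_right_strictAnti₀ (zero_lt_iff.2 hv0) hw1).injective e
    omega
  rw [Valuation.map_add_of_distinct_val _ hne, hn, hdw]
  rcases max_choice (B.valuation w ^ (2 * n)) (B.valuation w ^ (2 * m + 1)) with e | e
  · exact ⟨_, e⟩
  · exact ⟨_, e⟩

/-- For integral r the norm (r + w)(r - s - w) is the quadratic evaluated at -r, hence a unit; both
factors are integral, so both are units. The resulting formula for v(c + d w) shows that B is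
determined by A and that the value group does not grow. -/
theorem valuation_add_eq_max (h : IsQuadraticGenerator w s t)
    (hB : B.comap (algebraMap K L) = A) (hs : s ∈ A) (ht : t ∈ A)
    (hroot : ∀ r ∈ A, A.valuation (r ^ 2 + s * r + t) = 1) (r : K) :
    B.valuation (algebraMap K L r + w) = max (B.valuation (algebraMap K L r)) 1 := by
  have hw : B.valuation w ≤ 1 := (valuation_le_one_iff _ _).2 (h.mem_of_mem hB hs ht)
  have hs' : B.valuation (algebraMap K L s) ≤ 1 :=
    (valuation_le_one_of_comap_eq hB s).2 ((valuation_le_one_iff _ _).2 hs)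
  rcases le_or_gt (B.valuation (algebraMap K L r)) 1 with hr | hr
  · rw [max_eq_right hr]
    have hprod : (algebraMap K L r + w) * (algebraMap K L r - algebraMap K L s - w) =
        algebraMap K L ((-r) ^ 2 + s * (-r) + t) := by
      simp only [map_add, map_mul, map_pow, map_neg]
      linear_combination -h.sq_add_mul_add
    have h1 := (valuation_eq_one_of_comap_eq hB _).2 (hroot (-r)
      (neg_mem ((valuation_le_one_iff _ _).1 ((valuation_le_one_of_comap_eq hB r).1 hr))))
    rw [← hprod, map_mul] at h1
    have h2 : B.valuation (algebraMap K L r + w) ≤ 1 :=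
      (Valuation.map_add _ _ _).trans (max_le hr hw)
    have h3 : B.valuation (algebraMap K L r - algebraMap K L s - w) ≤ 1 :=
      (Valuation.map_sub _ _ _).trans (max_le ((Valuation.map_sub _ _ _).trans (max_le hr hs')) hw)
    refine le_antisymm h2 ?_
    rw [← h1]
    exact mul_le_of_le_one_right (zero_le) h3
  · rw [max_eq_left hr.le, Valuation.map_add_eq_of_lt_left _ (hw.trans_lt hr)]

theorem valuation_add_mul_eq_max (h : IsQuadraticGenerator w s t)
    (hB : B.comap (algebraMap K L) = A) (hs : s ∈ A) (ht : t ∈ A)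
    (hroot : ∀ r ∈ A, A.valuation (r ^ 2 + s * r + t) = 1) (c d : K) :
    B.valuation (algebraMap K L c + algebraMap K L d * w) =
      max (B.valuation (algebraMap K L c)) (B.valuation (algebraMap K L d)) := by
  rcases eq_or_ne d 0 with rfl | hd
  · simp
  have hd' : algebraMap K L d ≠ 0 := (map_ne_zero _).2 hd
  have : algebraMap K L c + algebraMap K L d * w =
      algebraMap K L d * (algebraMap K L (c / d) + w) := by
    rw [map_div₀]; field_simp
  rw [this, map_mul, h.valuation_add_eq_max hB hs ht hroot, map_div₀, map_div₀,
    mul_max, mul_one,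
    mul_div_cancel₀ _ ((Valuation.ne_zero_iff _).2 hd')]

theorem isUniformizer_of_inert [Algebra.IsQuadraticExtension K L]
    (h : IsQuadraticGenerator w s t) (hB : B.comap (algebraMap K L) = A)
    (hp : A.IsUniformizer p) (hs : s ∈ A) (ht : t ∈ A)
    (hroot : ∀ r ∈ A, A.valuation (r ^ 2 + s * r + t) = 1) :
    B.IsUniformizer (algebraMap K L p) := by
  have hK : ∀ c : K, c ≠ 0 →
      ∃ n : ℤ, B.valuation (algebraMap K L c) = B.valuation (algebraMap K L p) ^ n := by
    intro c hc
    obtain ⟨n, hn⟩ := hp.exists_zpow c hc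
    rw [← map_zpow₀, ← valuation_eq_of_comap_eq hB, map_zpow₀, map_zpow₀] at hn
    exact ⟨n, hn⟩
  refine ⟨(map_ne_zero _).2 hp.ne_zero, (valuation_lt_one_of_comap_eq hB p).2 hp.lt_one,
    fun z hz => ?_⟩
  obtain ⟨c, d, rfl⟩ := h.exists_eq_add_mul z
  rw [h.valuation_add_mul_eq_max hB hs ht hroot]
  have hne : algebraMap K L c + algebraMap K L d * w ≠ 0 := hz
  rw [← Valuation.ne_zero_iff B.valuation, h.valuation_add_mul_eq_max hB hs ht hroot] at hne
  rcases max_choice (B.valuation (algebraMap K L c)) (B.valuation (algebraMap K L d)) with e | e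
  all_goals
    rw [e] at hne ⊢
    exact hK _ ((map_ne_zero _).1 ((Valuation.ne_zero_iff _).1 hne))

theorem eq_of_comap_eq [Algebra.IsQuadraticExtension K L]
    (h : IsQuadraticGenerator w s t) {B' : ValuationSubring L} (hB : B.comap (algebraMap K L) = A)
    (hB' : B'.comap (algebraMap K L) = A) (hs : s ∈ A) (ht : t ∈ A)
    (hroot : ∀ r ∈ A, A.valuation (r ^ 2 + s * r + t) = 1) : B = B' := by
  ext z
  obtain ⟨c, d, rfl⟩ := h.exists_eq_add_mul z
  rw [← valuation_le_one_iff, ← valuation_le_one_iff,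
    h.valuation_add_mul_eq_max hB hs ht hroot, h.valuation_add_mul_eq_max hB' hs ht hroot,
    max_le_iff, max_le_iff, valuation_le_one_of_comap_eq hB, valuation_le_one_of_comap_eq hB,
    valuation_le_one_of_comap_eq hB', valuation_le_one_of_comap_eq hB']

/-- The extension is immediate: every element has the same leading term as some element of K. This
gives both e = 1 and f = 1. -/
theorem exists_valuation_sub_lt [Algebra.IsQuadraticExtension K L]
    (h : IsQuadraticGenerator w s t) (hB : B.comap (algebraMap K L) = A)
    (hs : A.valuation s = 1) (hw : B.valuation w < 1) {z : L} (hz : z ≠ 0) :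
    ∃ c : K, B.valuation (z - algebraMap K L c) < B.valuation z := by
  rw [← valuation_eq_one_of_comap_eq hB] at hs
  have main : ∀ r : K, ∃ c : K, B.valuation (algebraMap K L r + w - algebraMap K L c) <
      B.valuation (algebraMap K L r + w) := by
    intro r
    have hne : algebraMap K L r + w ≠ 0 :=
      fun e => h.algebraMap_ne (-r) (by rw [map_neg]; linear_combination -e)
    rcases lt_or_ge (B.valuation (algebraMap K L r)) 1 with hr | hr
    · let n : K := (-r) ^ 2 + s * (-r) + t
      let u : L := algebraMap K L r - algebraMap K L s - w
      have hprod : (algebraMap K L r + w) * u = algebraMap K L n := by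
        simp only [n, u, map_add, map_mul, map_pow, map_neg]
        linear_combination -h.sq_add_mul_add
      have hlt : B.valuation (algebraMap K L r - w) < 1 :=
        (Valuation.map_sub _ _ _).trans_lt (max_lt hr hw)
      have hu : B.valuation u = 1 := by
        have : u = (algebraMap K L r - w) - algebraMap K L s := by simp only [u]; ring
        rw [this, Valuation.map_sub_eq_of_lt_right _ (hlt.trans_eq hs.symm), hs]
      have hu0 : u ≠ 0 := by rintro e; simp [e] at hu
      have hs0 : algebraMap K L s ≠ 0 := by rintro e; simp [e] at hs
      -- The conjugate factor u is congruent to -s, so r + w = n / u is approximated by -n / s.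
      refine ⟨-n / s, ?_⟩
      have hdiff : algebraMap K L r + w - algebraMap K L (-n / s) =
          (algebraMap K L r + w) * ((algebraMap K L r - w) / algebraMap K L s) := by
        rw [map_div₀, map_neg, ← hprod]
        field_simp
        simp only [u]
        ring
      rw [hdiff, map_mul, map_div₀, hs, div_one]
      exact mul_lt_of_lt_one_right (zero_lt_iff.2 ((Valuation.ne_zero_iff _).2 hne)) hlt
    · refine ⟨r, ?_⟩
      rw [Valuation.map_add_eq_of_lt_left _ (hw.trans_le hr), add_sub_cancel_left]
      exact hw.trans_le hr
  obtain ⟨c, d, rfl⟩ := h.exists_eq_add_mul z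
  rcases eq_or_ne d 0 with rfl | hd
  · refine ⟨c, ?_⟩
    simp only [map_zero, zero_mul, add_zero, sub_self] at hz ⊢
    exact zero_lt_iff.2 ((Valuation.ne_zero_iff _).2 hz)
  have hd' : algebraMap K L d ≠ 0 := (map_ne_zero _).2 hd
  have : algebraMap K L c + algebraMap K L d * w =
      algebraMap K L d * (algebraMap K L (c / d) + w) := by
    rw [map_div₀]; field_simp
  obtain ⟨e, he⟩ := main (c / d)
  refine ⟨d * e, ?_⟩
  rw [this, map_mul (algebraMap K L), ← mul_sub, map_mul, map_mul]
  exact mul_lt_mul_of_pos_left he (zero_lt_iff.2 ((Valuation.ne_zero_iff _).2 hd'))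

theorem isUniformizer_of_split [Algebra.IsQuadraticExtension K L]
    (h : IsQuadraticGenerator w s t) (hB : B.comap (algebraMap K L) = A)
    (hp : A.IsUniformizer p) (hs : A.valuation s = 1) (hw : B.valuation w < 1) :
    B.IsUniformizer (algebraMap K L p) := by
  refine ⟨(map_ne_zero _).2 hp.ne_zero, (valuation_lt_one_of_comap_eq hB p).2 hp.lt_one,
    fun z hz => ?_⟩
  obtain ⟨c, hc⟩ := h.exists_valuation_sub_lt hB hs hw hz
  have hzc : B.valuation z = B.valuation (algebraMap K L c) := by
    have : algebraMap K L c = z - (z - algebraMap K L c) := by ring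
    rw [this, Valuation.map_sub_eq_of_lt_left _ hc]
  have hc0 : c ≠ 0 := by
    rintro rfl
    rw [map_zero, map_zero, Valuation.zero_iff] at hzc
    exact hz hzc
  obtain ⟨n, hn⟩ := hp.exists_zpow c hc0
  rw [← map_zpow₀, ← valuation_eq_of_comap_eq hB, map_zpow₀, map_zpow₀] at hn
  exact ⟨n, hzc.trans hn⟩

theorem valuation_lt_one_or (h : IsQuadraticGenerator w s t)
    (hB : B.comap (algebraMap K L) = A) (ht : A.valuation t < 1) :
    B.valuation w < 1 ∨ B.valuation (-algebraMap K L s - w) < 1 := by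
  have h1 : w * (-algebraMap K L s - w) = algebraMap K L t := by
    linear_combination -h.sq_add_mul_add
  rw [← valuation_lt_one_of_comap_eq hB, ← h1, map_mul] at ht
  by_contra! hcon
  exact absurd (one_le_mul hcon.1 hcon.2) (not_le.2 ht)

end Valuation

end IsQuadraticGenerator

/-! ### Ramified, split and inert points of a quadratic extension. -/

namespace ClosedPoint

open ValuationSubring

variable {k K L : Type*} [Field k] [Field K] [Field L] [Algebra k K] [Algebra k L] [Algebra K L]
  {x : ClosedPoint k K} {p : K} {w : L} {s t : K}

theorem LiesOver.ramificationIdx_eq_one {y : ClosedPoint k L} (hy : y.LiesOver x)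
    (hp : x.localRing.IsUniformizer p) (hp' : y.localRing.IsUniformizer (algebraMap K L p)) :
    hy.ramificationIdx = 1 :=
  hy.ramificationIdx_eq hp hp' (pow_one _).symm

theorem IsSplit.not_isRamified (h : x.IsSplit L) : ¬ x.IsRamified L := by
  rintro ⟨y, hy, he⟩
  rw [(h y hy).1] at he
  exact he.false

/-- At each y one of the two roots w, -s - w has value below 1, since their product is t. The
hypotheses are symmetric in the two roots, so w may be taken to be that one, and the extension is
then immediate at y. -/
theorem isSplit_of_isQuadraticGenerator [Algebra.IsQuadraticExtension K L]
    (hp : x.localRing.IsUniformizer p)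
    (h : IsQuadraticGenerator w s t) (hs : x.localRing.valuation s = 1)
    (ht : x.localRing.valuation t < 1) : x.IsSplit L := by
  intro y hy
  wlog hw : y.localRing.valuation w < 1 generalizing w
  · exact this h.conj ((h.valuation_lt_one_or hy ht).resolve_left hw)
  have hpy := h.isUniformizer_of_split hy hp hs hw
  refine ⟨hy.ramificationIdx_eq_one hp hpy, hy.inertiaDeg_eq_one_iff.2 fun z hz => ?_⟩
  rw [← valuation_le_one_iff] at hz
  rcases eq_or_ne z 0 with rfl | hz0
  · exact ⟨0, x.localRing.zero_mem, by simp⟩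
  obtain ⟨c, hc⟩ := h.exists_valuation_sub_lt hy hs hw hz0
  refine ⟨c, ?_, hc.trans_le hz⟩
  rw [← valuation_le_one_iff, ← valuation_le_one_of_comap_eq hy]
  have : algebraMap K L c = z - (z - algebraMap K L c) := by ring
  rw [this, Valuation.map_sub_eq_of_lt_left _ hc]
  exact hz

variable [IsScalarTower k K L]

theorem exists_liesOver (hp : x.localRing.IsUniformizer p) :
    ∃ y : ClosedPoint k L, y.LiesOver x := by
  obtain ⟨B, hB⟩ := exists_comap_eq hp (algebraMap K L)
  refine ⟨⟨B, fun c => ?_, ?_⟩, hB⟩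
  · have := x.algebraMap_mem c
    rw [← hB, mem_comap, ← IsScalarTower.algebraMap_apply] at this
    exact this
  · rintro rfl
    exact x.ne_top (by rw [← hB]; rfl)

theorem LiesOver.exists_conj {y : ClosedPoint k L} (h : y.LiesOver x) (σ : L ≃ₐ[K] L) :
    ∃ y' : ClosedPoint k L, y'.LiesOver x ∧ ∀ z, z ∈ y'.localRing ↔ σ z ∈ y.localRing := by
  refine ⟨⟨y.localRing.comap σ, fun c => ?_, fun htop => y.ne_top ?_⟩, ?_, fun z => Iff.rfl⟩
  · have hc : σ (algebraMap k L c) = algebraMap k L c := by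
      rw [IsScalarTower.algebraMap_apply k K L, σ.commutes]
    change σ (algebraMap k L c) ∈ y.localRing
    rw [hc]
    exact y.algebraMap_mem c
  · rw [_root_.eq_top_iff]
    intro z _
    have : σ.symm z ∈ y.localRing.comap (σ : L →+* L) := htop ▸ ValuationSubring.mem_top _
    simpa [mem_comap] using this
  · have hσ : (σ : L →+* L).comp (algebraMap K L) = algebraMap K L := RingHom.ext σ.commutes
    change (y.localRing.comap (σ : L →+* L)).comap (algebraMap K L) = x.localRing
    rw [comap_comap, hσ]
    exact h

/-- The residue of w does not come from k(x), so f ≠ 1. A point over x has to be produced, because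
`IsSplit` would hold vacuously on an empty fibre. -/
theorem not_isSplit_of_isQuadraticGenerator (hp : x.localRing.IsUniformizer p)
    (h : IsQuadraticGenerator w s t) (hs : s ∈ x.localRing) (ht : t ∈ x.localRing)
    (hroot : ∀ r ∈ x.localRing, x.localRing.valuation (r ^ 2 + s * r + t) = 1) :
    ¬ x.IsSplit L := by
  obtain ⟨y, hy⟩ := exists_liesOver (L := L) hp
  intro hsplit
  obtain ⟨c, hc, hcw⟩ := hy.inertiaDeg_eq_one_iff.1 (hsplit y hy).2 w (h.mem_of_mem hy hs ht)
  have h1 := h.valuation_add_eq_max hy hs ht hroot (-c)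
  rw [map_neg, neg_add_eq_sub] at h1
  rw [h1] at hcw
  exact (lt_of_le_of_lt (le_max_right _ _) hcw).false

variable [Algebra.IsQuadraticExtension K L]

theorem isRamified_of_isQuadraticGenerator (hp : x.localRing.IsUniformizer p)
    (h : IsQuadraticGenerator w s t) (hs : x.localRing.valuation s < 1)
    (ht : x.localRing.valuation t = x.localRing.valuation p) : x.IsRamified L := by
  obtain ⟨y, hy⟩ := exists_liesOver (L := L) hp
  refine ⟨y, hy, ?_⟩
  rw [hy.ramificationIdx_eq hp (h.isUniformizer_of_ramified hy hp hs ht)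
    (h.valuation_sq_eq hy hp hs ht)]
  exact one_lt_two

theorem isInert_of_isQuadraticGenerator (hp : x.localRing.IsUniformizer p)
    (h : IsQuadraticGenerator w s t) (hs : s ∈ x.localRing) (ht : t ∈ x.localRing)
    (hroot : ∀ r ∈ x.localRing, x.localRing.valuation (r ^ 2 + s * r + t) = 1) :
    x.IsInert L := by
  refine ⟨?_, ?_⟩
  · rintro ⟨y, hy, he⟩
    rw [hy.ramificationIdx_eq_one hp (h.isUniformizer_of_inert hy hp hs ht hroot)] at he
    exact he.false
  · obtain ⟨y, hy⟩ := exists_liesOver (L := L) hp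
    refine ⟨y, hy, fun y' hy' => ?_⟩
    have := h.eq_of_comap_eq hy' hy hs ht hroot
    cases y; cases y'; simp only at this; subst this; rfl

/-- A unique point over x would be fixed by conjugation. Both roots would then lie in its maximal
ideal, and so would their sum -s, which is a unit. -/
theorem not_isInert_of_isQuadraticGenerator (hp : x.localRing.IsUniformizer p)
    (h : IsQuadraticGenerator w s t) (hs : x.localRing.valuation s = 1)
    (ht : x.localRing.valuation t < 1) : ¬ x.IsInert L := by
  rintro ⟨-, huniq⟩
  obtain ⟨σ, hσ⟩ := h.exists_algEquiv
  obtain ⟨y, hy⟩ := exists_liesOver (L := L) hp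
  obtain ⟨y', hy', hyy⟩ := hy.exists_conj σ
  obtain rfl := huniq.unique hy hy'
  have hw0 : w ≠ 0 := fun e => h.algebraMap_ne 0 (by rw [e, map_zero])
  have key : y.localRing.valuation w < 1 ↔ y.localRing.valuation (σ w) < 1 := by
    rw [valuation_lt_one_iff_inv_notMem _ hw0,
      valuation_lt_one_iff_inv_notMem _ ((map_ne_zero σ).2 hw0), hyy, map_inv₀]
  have hboth : y.localRing.valuation w < 1 ∧ y.localRing.valuation (σ w) < 1 := by
    rw [← key, and_self]
    rcases h.valuation_lt_one_or hy ht with h1 | h1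
    · exact h1
    · rw [key, hσ]; exact h1
  rw [hσ] at hboth
  have hs1 := (valuation_eq_one_of_comap_eq hy s).2 hs
  have : algebraMap K L s = -(-algebraMap K L s - w) - w := by ring
  rw [this] at hs1
  refine absurd hs1 (ne_of_lt ((Valuation.map_sub _ _ _).trans_lt (max_lt ?_ hboth.1)))
  rw [Valuation.map_neg]
  exact hboth.2

end ClosedPoint
end

/-! ### Closed points of the projective line. -/

noncomputable section

namespace ClosedPoint

open ValuationSubring

section Trivial

variable {k K : Type*} [Field k] [Field K] [Algebra k K] (x : ClosedPoint k K)

instance isTrivialOn_valuation : x.localRing.valuation.IsTrivialOn k := by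
  refine ⟨fun c hc => le_antisymm ?_ ?_⟩
  · exact (valuation_le_one_iff _ _).2 (x.algebraMap_mem c)
  · have h := (valuation_le_one_iff _ _).2 (x.algebraMap_mem c⁻¹)
    rwa [map_inv₀, map_inv₀, inv_le_one₀ (zero_lt_iff.2 ?_)] at h
    rw [Valuation.ne_zero_iff]
    exact (map_ne_zero _).2 hc

instance isNontrivial_valuation : x.localRing.valuation.IsNontrivial := by
  have := x.ne_top
  rwa [Ne, ValuationSubring.eq_top_iff, not_not] at this

theorem residue_eq_iff (a b : x.localRing) :
    IsLocalRing.residue x.localRing a = IsLocalRing.residue x.localRing b ↔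
      x.localRing.valuation ((a : K) - b) < 1 := by
  rw [← sub_eq_zero, ← map_sub, IsLocalRing.residue_eq_zero_iff, valuation_lt_one_iff]
  rfl

theorem eq_of_localRing_eq {x y : ClosedPoint k K} (h : x.localRing = y.localRing) : x = y := by
  cases x; cases y; simp only at h; subst h; rfl

end Trivial

variable {F : Type*} [Field F] {x : ClosedPoint F (RatFunc F)} {p : F[X]}

/-- The closed point `x` of the projective line lies in the affine line, and the polynomial `p`
vanishes there. -/
structure IsZeroOf (x : ClosedPoint F (RatFunc F)) (p : F[X]) : Prop where
  valuation_X_le_one : x.localRing.valuation RatFunc.X ≤ 1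
  valuation_lt_one : x.localRing.valuation (algebraMap F[X] (RatFunc F) p) < 1

theorem valuation_algebraMap_le_one (hX : x.localRing.valuation RatFunc.X ≤ 1) (f : F[X]) :
    x.localRing.valuation (algebraMap F[X] (RatFunc F) f) ≤ 1 := by
  rw [valuation_le_one_iff] at hX ⊢
  induction f using Polynomial.induction_on' with
  | add f g hf hg => rw [map_add]; exact x.localRing.add_mem _ _ hf hg
  | monomial n c =>
    rw [← Polynomial.C_mul_X_pow_eq_monomial, map_mul, map_pow, RatFunc.algebraMap_X]
    refine x.localRing.mul_mem _ _ ?_ (pow_mem hX n)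
    rw [← Polynomial.algebraMap_eq, ← IsScalarTower.algebraMap_apply]
    exact x.algebraMap_mem c

namespace IsZeroOf

theorem algebraMap_mem (h : x.IsZeroOf p) (f : F[X]) :
    algebraMap F[X] (RatFunc F) f ∈ x.localRing :=
  (valuation_le_one_iff _ _).1 (valuation_algebraMap_le_one h.valuation_X_le_one f)

theorem valuation_lt_one_iff (h : x.IsZeroOf p) (hp : Irreducible p) {f : F[X]} :
    x.localRing.valuation (algebraMap F[X] (RatFunc F) f) < 1 ↔ p ∣ f := by
  have hle := valuation_algebraMap_le_one h.valuation_X_le_one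
  constructor
  · intro hf
    by_contra hpf
    obtain ⟨a, b, hab⟩ := (hp.coprime_iff_not_dvd).2 hpf
    have h1 : x.localRing.valuation (algebraMap F[X] (RatFunc F) (a * p + b * f)) < 1 := by
      rw [map_add, map_mul, map_mul]
      refine (Valuation.map_add _ _ _).trans_lt (max_lt ?_ ?_)
      · rw [map_mul]
        exact mul_lt_one_of_nonneg_of_lt_one_right (hle a) (zero_le) h.valuation_lt_one
      · rw [map_mul]
        exact mul_lt_one_of_nonneg_of_lt_one_right (hle b) (zero_le) hf
    rw [hab, map_one, map_one] at h1
    exact h1.false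
  · rintro ⟨g, rfl⟩
    rw [map_mul, map_mul]
    exact mul_lt_one_of_nonneg_of_lt_one_left (zero_le) h.valuation_lt_one (hle g)

theorem valuation_eq_one_iff (h : x.IsZeroOf p) (hp : Irreducible p) {f : F[X]} :
    x.localRing.valuation (algebraMap F[X] (RatFunc F) f) = 1 ↔ ¬ p ∣ f := by
  rw [← h.valuation_lt_one_iff hp, not_lt]
  exact ⟨fun e => e.ge, fun e => le_antisymm (valuation_algebraMap_le_one h.valuation_X_le_one f) e⟩

theorem exists_valuation_eq_pow (h : x.IsZeroOf p) (hp : Irreducible p) {f : F[X]} (hf : f ≠ 0) :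
    ∃ n : ℕ, x.localRing.valuation (algebraMap F[X] (RatFunc F) f) =
      x.localRing.valuation (algebraMap F[X] (RatFunc F) p) ^ n := by
  obtain ⟨g, hg, hgp⟩ := (FiniteMultiplicity.of_not_isUnit hp.not_isUnit
    hf).exists_eq_pow_mul_and_not_dvd
  refine ⟨multiplicity p f, ?_⟩
  conv_lhs => rw [hg]
  rw [map_mul, map_mul, (h.valuation_eq_one_iff hp).2 hgp, mul_one, map_pow, map_pow]

theorem isUniformizer (h : x.IsZeroOf p) (hp : Irreducible p) :
    x.localRing.IsUniformizer (algebraMap F[X] (RatFunc F) p) := by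
  have hp0 : algebraMap F[X] (RatFunc F) p ≠ 0 := RatFunc.algebraMap_ne_zero hp.ne_zero
  refine ⟨hp0, h.valuation_lt_one, fun z hz => ?_⟩
  obtain ⟨m, hm⟩ := h.exists_valuation_eq_pow hp (RatFunc.num_ne_zero hz)
  obtain ⟨n, hn⟩ := h.exists_valuation_eq_pow hp (RatFunc.denom_ne_zero z)
  refine ⟨m - n, ?_⟩
  rw [← RatFunc.num_div_denom z, map_div₀, hm, hn,
    zpow_sub₀ ((Valuation.ne_zero_iff _).2 hp0), zpow_natCast, zpow_natCast]

theorem not_dvd_denom (h : x.IsZeroOf p) (hp : Irreducible p) {z : RatFunc F}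
    (hz : z ∈ x.localRing) : ¬ p ∣ z.denom := by
  intro hd
  have hn : ¬ p ∣ z.num := fun hn => hp.not_isUnit (z.isCoprime_num_denom.isUnit_of_dvd' hn hd)
  have h1 := (valuation_le_one_iff _ _).2 hz
  rw [← RatFunc.num_div_denom z, map_div₀, (h.valuation_eq_one_iff hp).2 hn, one_div,
    inv_le_one₀ (zero_lt_iff.2 ((Valuation.ne_zero_iff _).2
      (RatFunc.algebraMap_ne_zero z.denom_ne_zero)))] at h1
  exact absurd ((h.valuation_lt_one_iff hp).2 hd) (not_lt.2 h1)

theorem unique (h : x.IsZeroOf p) (hp : Irreducible p) {x' : ClosedPoint F (RatFunc F)}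
    (h' : x'.IsZeroOf p) : x = x' := by
  refine eq_of_localRing_eq ((h.isUniformizer hp).eq_of_le (fun z hz => ?_) x'.ne_top)
  rw [← valuation_le_one_iff, ← RatFunc.num_div_denom z, map_div₀,
    (h'.valuation_eq_one_iff hp).2 (h.not_dvd_denom hp hz), div_one]
  exact valuation_algebraMap_le_one h'.valuation_X_le_one _

theorem dvd (h : x.IsZeroOf p) (hp : Irreducible p) {p' : F[X]} (h' : x.IsZeroOf p') : p ∣ p' :=
  (h.valuation_lt_one_iff hp).1 h'.valuation_lt_one

/-- The denominator of z is prime to p, so it can be inverted modulo p by a polynomial b from a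
Bézout relation. Thus F[X] maps onto the residue field. -/
theorem exists_polynomial (h : x.IsZeroOf p) (hp : Irreducible p) {z : RatFunc F}
    (hz : z ∈ x.localRing) :
    ∃ f : F[X], x.localRing.valuation (z - algebraMap F[X] (RatFunc F) f) < 1 := by
  have hd := h.not_dvd_denom hp hz
  obtain ⟨a, b, hab⟩ := (hp.coprime_iff_not_dvd).2 hd
  refine ⟨z.num * b, ?_⟩
  have hz' : z - algebraMap F[X] (RatFunc F) (z.num * b) =
      z * algebraMap F[X] (RatFunc F) (a * p) := by
    have h1 : algebraMap F[X] (RatFunc F) (a * p) =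
        1 - algebraMap F[X] (RatFunc F) b * algebraMap F[X] (RatFunc F) z.denom := by
      rw [← map_mul, ← map_one (algebraMap F[X] (RatFunc F)), ← map_sub, ← hab,
        add_sub_cancel_right]
    have h2 : algebraMap F[X] (RatFunc F) z.num = z * algebraMap F[X] (RatFunc F) z.denom := by
      rw [← div_eq_iff (RatFunc.algebraMap_ne_zero z.denom_ne_zero), RatFunc.num_div_denom]
    rw [h1, map_mul, h2]
    ring
  rw [hz', map_mul]
  exact mul_lt_one_of_nonneg_of_lt_one_right ((valuation_le_one_iff _ _).2 hz) (zero_le)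
    ((h.valuation_lt_one_iff hp).2 (dvd_mul_left p a))

/-- Reduction of polynomials identifies the residue field with F[X]/(p). -/
theorem degree_eq (h : x.IsZeroOf p) (hp : Irreducible p) : x.degree = p.natDegree := by
  let X' : x.localRing := ⟨algebraMap F[X] (RatFunc F) Polynomial.X, h.algebraMap_mem _⟩
  let φ : F[X] →ₐ[F] x.residueField := Polynomial.aeval (IsLocalRing.residue _ X')
  have hφ : ∀ f, φ f = IsLocalRing.residue _ ⟨algebraMap F[X] (RatFunc F) f, h.algebraMap_mem f⟩ :=
    by
    intro f
    let ψ : F[X] →+* x.localRing :=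
      (algebraMap F[X] (RatFunc F)).codRestrict x.localRing.toSubring h.algebraMap_mem
    have : (φ : F[X] →+* x.residueField) = (IsLocalRing.residue x.localRing).comp ψ := by
      refine Polynomial.ringHom_ext (fun c => ?_) ?_
      · have h1 : φ (Polynomial.C c) = algebraMap F _ c := φ.commutes c
        have h2 : ψ (Polynomial.C c) = algebraMap F x.localRing c := by
          apply Subtype.ext
          change algebraMap F[X] (RatFunc F) (algebraMap F F[X] c) = algebraMap F (RatFunc F) c
          rw [← IsScalarTower.algebraMap_apply]
        rw [RingHom.comp_apply, h2]
        exact h1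
      · exact Polynomial.aeval_X _
    exact DFunLike.congr_fun this f
  have hsurj : Function.Surjective φ := by
    intro z
    obtain ⟨z, rfl⟩ := IsLocalRing.residue_surjective z
    obtain ⟨f, hf⟩ := h.exists_polynomial hp z.2
    refine ⟨f, ?_⟩
    rw [hφ, eq_comm, residue_eq_iff]
    exact hf
  have hker : RingHom.ker φ = Ideal.span {p} := by
    ext f
    rw [RingHom.mem_ker, hφ, Ideal.mem_span_singleton, ← h.valuation_lt_one_iff hp,
      ← map_zero (IsLocalRing.residue x.localRing), residue_eq_iff]
    simp
  rw [degree, ← (Ideal.quotientKerAlgEquivOfSurjective hsurj).toLinearEquiv.finrank_eq,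
    (Ideal.quotientEquivAlgOfEq F hker).toLinearEquiv.finrank_eq,
    finrank_quotient_span_eq_natDegree]

end IsZeroOf

theorem exists_isZeroOf (hp : Irreducible p) : ∃ x : ClosedPoint F (RatFunc F), x.IsZeroOf p := by
  let u : IsDedekindDomain.HeightOneSpectrum F[X] :=
    ⟨Ideal.span {p}, (PrincipalIdealRing.isMaximal_of_irreducible hp).isPrime,
      by simpa using hp.ne_zero⟩
  let v := u.valuation (RatFunc F)
  have hv : v.IsEquiv v.valuationSubring.valuation := v.isEquiv_valuation_valuationSubring
  have hlt : v (algebraMap F[X] (RatFunc F) p) < 1 :=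
    (u.valuation_lt_one_iff_mem p).2 (Ideal.mem_span_singleton_self p)
  refine ⟨⟨v.valuationSubring, fun c => ?_, ?_⟩, ?_, ?_⟩
  · rw [IsScalarTower.algebraMap_apply F F[X] (RatFunc F)]
    exact u.valuation_le_one _
  · rw [Ne, Valuation.valuationSubring_eq_top_iff, not_not]
    exact ⟨_, (Valuation.ne_zero_iff _).2 (RatFunc.algebraMap_ne_zero hp.ne_zero), hlt.ne⟩
  · rw [valuation_le_one_iff, Valuation.mem_valuationSubring_iff, ← RatFunc.algebraMap_X]
    exact u.valuation_le_one _
  · exact hv.lt_one_iff_lt_one.1 hlt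

theorem exists_monic_isZeroOf (hX : x.localRing.valuation RatFunc.X ≤ 1) :
    ∃ p : F[X], p.Monic ∧ Irreducible p ∧ x.IsZeroOf p := by
  have hlt := RatFunc.valuation_uniformizingPolynomial_lt_one hX
  have hirr := RatFunc.irreducible_min_polynomial_valuation_lt_one_and_ne_zero
    (RatFunc.setOfPred_polynomial_valuation_lt_one_and_ne_zero_nonempty hX)
  set q := RatFunc.uniformizingPolynomial hX
  have hq : x.IsZeroOf q := ⟨hX, hlt⟩
  refine ⟨normalize q, Polynomial.monic_normalize hirr.ne_zero,
    (normalize_associated q).symm.irreducible hirr, hX, ?_⟩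
  exact (hq.valuation_lt_one_iff hirr).2 (dvd_normalize_iff.2 dvd_rfl)

section Infinity

theorem isUniformizer_inv_X (hX : 1 < x.localRing.valuation RatFunc.X) :
    x.localRing.IsUniformizer (RatFunc.X⁻¹ : RatFunc F) := by
  refine ⟨inv_ne_zero RatFunc.X_ne_zero, ?_, fun z hz => ⟨-z.intDegree, ?_⟩⟩
  · rw [map_inv₀]
    exact inv_lt_one_of_one_lt₀ hX
  · rw [RatFunc.valuation_eq_valuation_X_zpow_intDegree_of_one_lt_valuation_X hX hz, map_inv₀,
      inv_zpow', neg_neg]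

theorem eq_of_one_lt_valuation_X {x' : ClosedPoint F (RatFunc F)}
    (hX : 1 < x.localRing.valuation RatFunc.X) (hX' : 1 < x'.localRing.valuation RatFunc.X) :
    x = x' := by
  have h := (RatFunc.valuation_isEquiv_inftyValuation_of_one_lt_valuation_X hX).trans
    (RatFunc.valuation_isEquiv_inftyValuation_of_one_lt_valuation_X hX').symm
  refine eq_of_localRing_eq ?_
  rwa [Valuation.isEquiv_iff_valuationSubring, valuationSubring_valuation,
    valuationSubring_valuation] at h

theorem exists_one_lt_valuation_X :
    ∃ x : ClosedPoint F (RatFunc F), 1 < x.localRing.valuation RatFunc.X := by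
  let v := RatFunc.inftyValuation F
  have hX : 1 < v RatFunc.X := by simp [v, ← WithZero.exp_zero]
  refine ⟨⟨v.valuationSubring, fun c => ?_, ?_⟩, ?_⟩
  · rcases eq_or_ne c 0 with rfl | hc
    · rw [map_zero]; exact ValuationSubring.zero_mem _
    · exact (Valuation.IsTrivialOn.eq_one (v := v) c hc).le
  · rw [Ne, Valuation.valuationSubring_eq_top_iff, not_not]
    infer_instance
  · rw [← not_le, valuation_le_one_iff, Valuation.mem_valuationSubring_iff, not_le]
    exact hX

theorem degree_eq_one_of_one_lt_valuation_X (hX : 1 < x.localRing.valuation RatFunc.X) :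
    x.degree = 1 := by
  have hval := @RatFunc.valuation_eq_valuation_X_zpow_intDegree_of_one_lt_valuation_X
    F _ _ _ x.localRing.valuation
  rw [degree, finrank_eq_one_iff_of_nonzero' (1 : x.residueField) one_ne_zero]
  intro z
  obtain ⟨⟨z, hz⟩, rfl⟩ := IsLocalRing.residue_surjective z
  suffices ∃ c : F, x.localRing.valuation (algebraMap F (RatFunc F) c - z) < 1 by
    obtain ⟨c, hc⟩ := this
    refine ⟨c, ?_⟩
    rw [Algebra.smul_def, mul_one]
    exact (residue_eq_iff x (algebraMap F x.localRing c) ⟨z, hz⟩).2 hc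
  rw [← valuation_le_one_iff] at hz
  rcases hz.lt_or_eq with hz | hz
  · exact ⟨0, by rwa [map_zero, zero_sub, Valuation.map_neg]⟩
  have hz0 : z ≠ 0 := by rintro rfl; simp at hz
  have hdeg : z.intDegree = 0 := by
    by_contra hne
    rw [hval hX hz0] at hz
    exact hne ((zpow_right_strictMono₀ hX).injective (by simpa using hz))
  have hdeg' : z.num.natDegree = z.denom.natDegree := by
    rw [RatFunc.intDegree] at hdeg; omega
  -- Numerator and denominator have equal degrees and the denominator is monic, so c is the value of
  -- z at infinity.
  set c := z.num.leadingCoeff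
  have hc : c ≠ 0 := Polynomial.leadingCoeff_ne_zero.2 (RatFunc.num_ne_zero hz0)
  refine ⟨c, ?_⟩
  have hd0 : algebraMap F[X] (RatFunc F) z.denom ≠ 0 := RatFunc.algebraMap_ne_zero z.denom_ne_zero
  have hrep : algebraMap F (RatFunc F) c - z =
      algebraMap F[X] (RatFunc F) (Polynomial.C c * z.denom - z.num) /
        algebraMap F[X] (RatFunc F) z.denom := by
    rw [map_sub, map_mul, sub_div, mul_div_cancel_right₀ _ hd0, RatFunc.num_div_denom,
      ← Polynomial.algebraMap_eq, ← IsScalarTower.algebraMap_apply]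
  rcases eq_or_ne (Polynomial.C c * z.denom - z.num) 0 with h0 | h0
  · rw [hrep, h0]; simp
  have hdc : (Polynomial.C c * z.denom).degree = z.num.degree := by
    rw [Polynomial.degree_C_mul hc, Polynomial.degree_eq_natDegree z.denom_ne_zero, ← hdeg',
      Polynomial.degree_eq_natDegree (RatFunc.num_ne_zero hz0)]
  have hlt : (Polynomial.C c * z.denom - z.num).natDegree < z.denom.natDegree := by
    rw [← hdeg']
    refine Polynomial.natDegree_lt_natDegree h0 ?_
    rw [← hdc]
    refine Polynomial.degree_sub_lt_left hdc ?_ ?_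
    · exact mul_ne_zero (Polynomial.C_ne_zero.2 hc) z.denom_ne_zero
    · rw [Polynomial.leadingCoeff_mul, Polynomial.leadingCoeff_C,
        (RatFunc.monic_denom z).leadingCoeff, mul_one]
  rw [hrep, map_div₀, hval hX (RatFunc.algebraMap_ne_zero h0), hval hX hd0,
    RatFunc.intDegree_polynomial, RatFunc.intDegree_polynomial, zpow_natCast, zpow_natCast,
    div_lt_one₀ (pow_pos (zero_lt_one.trans hX) _)]
  exact pow_lt_pow_right₀ hX hlt

end Infinity

end ClosedPoint
end

/-! ### The Weierstrass double cover at each closed point. -/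

noncomputable section

namespace WeierstrassCurve

variable {F : Type*} [Field F] (W : WeierstrassCurve F)

/-- The coefficient of `y` in the Weierstrass equation, as a polynomial in `x`. -/
def yCoeff : F[X] := Polynomial.C W.a₁ * Polynomial.X + Polynomial.C W.a₃

/-- The coefficient of `1` in the Weierstrass equation, as a polynomial in `x`. -/
def oneCoeff : F[X] :=
  -(Polynomial.X ^ 3 + Polynomial.C W.a₂ * Polynomial.X ^ 2 + Polynomial.C W.a₄ * Polynomial.X +
    Polynomial.C W.a₆)

/-- The function `y` on `W`. -/
def yFun : W.toAffine.FunctionField :=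
  algebraMap W.toAffine.CoordinateRing W.toAffine.FunctionField
    (Affine.CoordinateRing.mk W.toAffine Polynomial.X)

instance : IsScalarTower F (RatFunc F) W.toAffine.FunctionField := by
  refine IsScalarTower.of_algebraMap_eq fun c => ?_
  rw [IsScalarTower.algebraMap_apply F F[X] (RatFunc F), ← IsScalarTower.algebraMap_apply F[X],
    ← IsScalarTower.algebraMap_apply]

instance : Algebra.IsQuadraticExtension (RatFunc F) W.toAffine.FunctionField := by
  have : Module.Finite F[X] W.toAffine.CoordinateRing :=
    Module.Finite.of_basis (Affine.CoordinateRing.basis W.toAffine)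
  have hrank := Algebra.IsAlgebraic.rank_of_isFractionRing F[X] (RatFunc F)
    W.toAffine.CoordinateRing W.toAffine.FunctionField
  rw [rank_eq_card_basis (Affine.CoordinateRing.basis W.toAffine), Fintype.card_fin] at hrank
  exact ⟨Module.finrank_eq_of_rank_eq hrank⟩

theorem isQuadraticGenerator_yFun :
    IsQuadraticGenerator W.yFun (algebraMap F[X] (RatFunc F) W.yCoeff)
      (algebraMap F[X] (RatFunc F) W.oneCoeff) := by
  constructor
  · rw [← IsScalarTower.algebraMap_apply, ← IsScalarTower.algebraMap_apply,
      IsScalarTower.algebraMap_apply F[X] W.toAffine.CoordinateRing _ W.yCoeff,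
      IsScalarTower.algebraMap_apply F[X] W.toAffine.CoordinateRing _ W.oneCoeff, yFun, ← map_pow,
      ← map_mul,
      ← map_add, ← map_add]
    have hpoly : Polynomial.X ^ 2 + Polynomial.C W.yCoeff * Polynomial.X +
        Polynomial.C W.oneCoeff = W.toAffine.polynomial := by
      rw [oneCoeff, Polynomial.C_neg, ← sub_eq_add_neg]
      rfl
    have h : Affine.CoordinateRing.mk W.toAffine (Polynomial.X ^ 2 +
        Polynomial.C W.yCoeff * Polynomial.X + Polynomial.C W.oneCoeff) = 0 :=
      (congrArg _ hpoly).trans AdjoinRoot.mk_self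
    rw [map_add, map_add, map_mul, map_pow] at h
    rw [← map_zero (algebraMap W.toAffine.CoordinateRing W.toAffine.FunctionField), ← h]
    rfl
  · intro c hc
    have hd : c.denom ≠ 0 := c.denom_ne_zero
    have hd' : algebraMap F[X] (RatFunc F) c.denom ≠ 0 := RatFunc.algebraMap_ne_zero hd
    have h1 : algebraMap F[X] W.toAffine.FunctionField c.num =
        algebraMap F[X] W.toAffine.FunctionField c.denom * W.yFun := by
      rw [← hc, IsScalarTower.algebraMap_apply F[X] (RatFunc F),
        IsScalarTower.algebraMap_apply F[X] (RatFunc F) _ c.denom, ← map_mul]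
      congr 1
      rw [mul_comm, ← div_eq_iff hd', RatFunc.num_div_denom]
    rw [IsScalarTower.algebraMap_apply F[X] W.toAffine.CoordinateRing,
      IsScalarTower.algebraMap_apply F[X] W.toAffine.CoordinateRing _ c.denom, yFun,
      ← map_mul] at h1
    have h2 := IsFractionRing.injective W.toAffine.CoordinateRing W.toAffine.FunctionField h1
    -- If y were a function of x, clearing denominators would give a linear relation over F[X]
    -- between the basis elements 1 and y.
    have h3 : (-c.num) • (1 : W.toAffine.CoordinateRing) +
        c.denom • Affine.CoordinateRing.mk W.toAffine Polynomial.X = 0 := by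
      rw [Algebra.smul_def, Algebra.smul_def, ← h2, map_neg]
      ring
    exact hd (Affine.CoordinateRing.smul_basis_eq_zero h3).2

/-- The polynomial obtained by substituting `y = r(x)` in the Weierstrass equation. -/
def subst (r : F[X]) : F[X] := r ^ 2 + W.yCoeff * r + W.oneCoeff

section Aeval

variable {E : Type*} [Field E] [Algebra F E] (x : E)

theorem aeval_yCoeff : Polynomial.aeval x W.yCoeff =
    (W.baseChange E).a₁ * x + (W.baseChange E).a₃ := by
  simp [yCoeff, WeierstrassCurve.baseChange]

theorem aeval_oneCoeff : Polynomial.aeval x W.oneCoeff =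
    -(x ^ 3 + (W.baseChange E).a₂ * x ^ 2 + (W.baseChange E).a₄ * x + (W.baseChange E).a₆) := by
  simp [oneCoeff, WeierstrassCurve.baseChange]

theorem equation_iff_aeval (y : E) : (W.baseChange E).toAffine.Equation x y ↔
    y ^ 2 + Polynomial.aeval x W.yCoeff * y + Polynomial.aeval x W.oneCoeff = 0 := by
  rw [Affine.equation_iff', aeval_yCoeff, aeval_oneCoeff]
  constructor <;> intro h <;> linear_combination h

/-- With f the Weierstrass polynomial, the derivative of f(x, r(x)) is f_x + r' f_y. The second
hypothesis says f_y = 0 at the point (x, r(x)) of the curve, so smoothness forces f_x ≠ 0. -/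
theorem derivative_subst_ne_zero [W.IsElliptic] (r : F[X])
    (h : Polynomial.aeval x (W.subst r) = 0)
    (h' : Polynomial.aeval x (2 * r + W.yCoeff) = 0) :
    Polynomial.aeval x (Polynomial.derivative (W.subst r)) ≠ 0 := by
  intro hd
  have heq : (W.baseChange E).toAffine.Equation x (Polynomial.aeval x r) := by
    rw [equation_iff_aeval]
    simpa [subst] using h
  have : (W.baseChange E).toAffine.IsElliptic := inferInstanceAs (W.map _).IsElliptic
  have hns := Affine.equation_iff_nonsingular.1 heq
  have hder : Polynomial.derivative (W.subst r) = Polynomial.derivative r * (2 * r + W.yCoeff) +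
      (Polynomial.C W.a₁ * r - (3 * Polynomial.X ^ 2 + 2 * Polynomial.C W.a₂ * Polynomial.X +
        Polynomial.C W.a₄)) := by
    simp only [subst, yCoeff, oneCoeff, Polynomial.derivative_add, Polynomial.derivative_mul,
      Polynomial.derivative_C, Polynomial.derivative_X, Polynomial.derivative_neg,
      Polynomial.derivative_pow]
    simp only [Nat.cast_ofNat, map_ofNat]
    ring
  rw [hder, map_add, map_mul, h', mul_zero, zero_add] at hd
  rw [Affine.nonsingular_iff'] at hns
  rcases hns.2 with hX | hY
  · apply hX
    simpa [WeierstrassCurve.baseChange, map_ofNat] using hd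
  · apply hY
    rw [map_add, aeval_yCoeff, map_mul] at h'
    simp only [map_ofNat] at h'
    linear_combination h'

end Aeval

/-- If p² divided `subst r`, its derivative would vanish at the root of p in F[X]/(p), contradicting
smoothness. This is what makes the shifted quadratic Eisenstein. -/
theorem not_sq_dvd_subst [W.IsElliptic] {p r : F[X]} (hp : Irreducible p) (h : p ∣ W.subst r)
    (h' : p ∣ 2 * r + W.yCoeff) : ¬ p ^ 2 ∣ W.subst r := by
  rintro ⟨g, hg⟩
  have : Fact (Irreducible p) := ⟨hp⟩
  have hz : ∀ f : F[X], p ∣ f → Polynomial.aeval (AdjoinRoot.root p) f = 0 := fun f hf => by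
    rw [AdjoinRoot.aeval_eq]
    exact AdjoinRoot.mk_eq_zero.2 hf
  refine W.derivative_subst_ne_zero (AdjoinRoot.root p) r (hz _ h) (hz _ h') (hz _ ?_)
  rw [hg, Polynomial.derivative_mul, Polynomial.derivative_pow]
  refine dvd_add (Dvd.dvd.mul_right (Dvd.dvd.mul_right (Dvd.dvd.mul_left ?_ _) _) _)
    (Dvd.dvd.mul_right ?_ _)
  · simp
  · exact dvd_pow_self p two_ne_zero

section ClosedPoint

variable {x : ClosedPoint F (RatFunc F)} {p r : F[X]}

theorem isQuadraticGenerator_sub (r : F[X]) :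
    IsQuadraticGenerator (W.yFun - algebraMap (RatFunc F) _ (algebraMap F[X] (RatFunc F) r))
      (algebraMap F[X] (RatFunc F) (2 * r + W.yCoeff))
      (algebraMap F[X] (RatFunc F) (W.subst r)) := by
  have := W.isQuadraticGenerator_yFun.sub_algebraMap (algebraMap F[X] (RatFunc F) r)
  simpa only [subst, map_add, map_mul, map_pow, map_ofNat] using this

theorem isRamified_of_dvd [W.IsElliptic] (hx : x.IsZeroOf p) (hp : Irreducible p)
    (h : p ∣ W.subst r) (h' : p ∣ 2 * r + W.yCoeff) : x.IsRamified W.toAffine.FunctionField := by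
  refine ClosedPoint.isRamified_of_isQuadraticGenerator (hx.isUniformizer hp)
    (W.isQuadraticGenerator_sub r) ((hx.valuation_lt_one_iff hp).2 h') ?_
  have hsq := W.not_sq_dvd_subst hp h h'
  obtain ⟨g, hg⟩ := h
  have hpg : ¬ p ∣ g := by
    rintro ⟨g', rfl⟩
    exact hsq ⟨g', by rw [hg]; ring⟩
  rw [hg, map_mul, map_mul, (hx.valuation_eq_one_iff hp).2 hpg, mul_one]

theorem isSplit_of_dvd (hx : x.IsZeroOf p) (hp : Irreducible p)
    (h : p ∣ W.subst r) (h' : ¬ p ∣ 2 * r + W.yCoeff) : x.IsSplit W.toAffine.FunctionField :=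
  ClosedPoint.isSplit_of_isQuadraticGenerator (hx.isUniformizer hp)
    (W.isQuadraticGenerator_sub r) ((hx.valuation_eq_one_iff hp).2 h')
    ((hx.valuation_lt_one_iff hp).2 h)

theorem not_isInert_of_dvd (hx : x.IsZeroOf p) (hp : Irreducible p)
    (h : p ∣ W.subst r) (h' : ¬ p ∣ 2 * r + W.yCoeff) : ¬ x.IsInert W.toAffine.FunctionField :=
  ClosedPoint.not_isInert_of_isQuadraticGenerator (hx.isUniformizer hp)
    (W.isQuadraticGenerator_sub r) ((hx.valuation_eq_one_iff hp).2 h')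
    ((hx.valuation_lt_one_iff hp).2 h)

theorem valuation_eq_one_of_forall_not_dvd (hx : x.IsZeroOf p) (hp : Irreducible p)
    (h : ∀ r, ¬ p ∣ W.subst r) : ∀ z ∈ x.localRing, x.localRing.valuation
      (z ^ 2 + algebraMap F[X] (RatFunc F) W.yCoeff * z + algebraMap F[X] (RatFunc F) W.oneCoeff) =
        1 := by
  intro z hz
  obtain ⟨r, hr⟩ := hx.exists_polynomial hp hz
  have h1 := (hx.valuation_eq_one_iff hp).2 (h r)
  have hsplit : z ^ 2 + algebraMap F[X] (RatFunc F) W.yCoeff * z +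
      algebraMap F[X] (RatFunc F) W.oneCoeff = (z - algebraMap F[X] (RatFunc F) r) *
        (z + algebraMap F[X] (RatFunc F) r + algebraMap F[X] (RatFunc F) W.yCoeff) +
        algebraMap F[X] (RatFunc F) (W.subst r) := by
    simp only [subst, map_add, map_mul, map_pow]
    ring
  rw [hsplit, Valuation.map_add_eq_of_lt_right _ ?_, h1]
  rw [h1]
  rw [map_mul]
  refine mul_lt_one_of_nonneg_of_lt_one_left (zero_le) hr ?_
  rw [ValuationSubring.valuation_le_one_iff]
  exact add_mem (add_mem hz (hx.algebraMap_mem _)) (hx.algebraMap_mem _)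

theorem isInert_of_forall_not_dvd (hx : x.IsZeroOf p) (hp : Irreducible p)
    (h : ∀ r, ¬ p ∣ W.subst r) : x.IsInert W.toAffine.FunctionField :=
  ClosedPoint.isInert_of_isQuadraticGenerator (hx.isUniformizer hp) W.isQuadraticGenerator_yFun
    (hx.algebraMap_mem _) (hx.algebraMap_mem _) (W.valuation_eq_one_of_forall_not_dvd hx hp h)

theorem not_isSplit_of_forall_not_dvd (hx : x.IsZeroOf p) (hp : Irreducible p)
    (h : ∀ r, ¬ p ∣ W.subst r) : ¬ x.IsSplit W.toAffine.FunctionField :=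
  ClosedPoint.not_isSplit_of_isQuadraticGenerator (hx.isUniformizer hp) W.isQuadraticGenerator_yFun
    (hx.algebraMap_mem _) (hx.algebraMap_mem _) (W.valuation_eq_one_of_forall_not_dvd hx hp h)

theorem isRamified_of_one_lt_valuation_X (hX : 1 < x.localRing.valuation RatFunc.X) :
    x.IsRamified W.toAffine.FunctionField := by
  have hval : ∀ f : F[X], f ≠ 0 → x.localRing.valuation (algebraMap F[X] (RatFunc F) f) =
      x.localRing.valuation RatFunc.X ^ f.natDegree := fun f hf => by
    rw [RatFunc.valuation_eq_valuation_X_zpow_intDegree_of_one_lt_valuation_X hX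
      (RatFunc.algebraMap_ne_zero hf), RatFunc.intDegree_polynomial, zpow_natCast]
  have hv0 : x.localRing.valuation (RatFunc.X : RatFunc F) ≠ 0 := (zero_lt_one.trans hX).ne'
  have hu : (RatFunc.X ^ (-2 : ℤ) : RatFunc F) ≠ 0 := zpow_ne_zero _ RatFunc.X_ne_zero
  -- For y/x² the linear coefficient has degree at most 1 - 2 and the constant term has degree 3 - 4
  -- = -1, the degree of the uniformizer 1/X: an Eisenstein equation.
  refine ClosedPoint.isRamified_of_isQuadraticGenerator (ClosedPoint.isUniformizer_inv_X hX)
    (W.isQuadraticGenerator_yFun.algebraMap_mul hu) ?_ ?_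
  · rcases eq_or_ne W.yCoeff 0 with h0 | h0
    · simp [h0]
    · rw [map_mul, map_zpow₀, hval _ h0, ← zpow_natCast, ← zpow_add₀ hv0]
      refine zpow_lt_one_of_neg₀ hX ?_
      have : W.yCoeff.natDegree ≤ 1 := by
        rw [yCoeff]; compute_degree
      omega
  · have hdeg : W.oneCoeff.natDegree = 3 := by
      rw [oneCoeff, Polynomial.natDegree_neg]; compute_degree!
    have h0 : W.oneCoeff ≠ 0 := by rintro h; simp [h] at hdeg
    rw [map_mul, map_pow, map_zpow₀, hval _ h0, hdeg, map_inv₀, ← zpow_natCast, ← zpow_natCast,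
      ← zpow_mul, ← zpow_add₀ hv0, ← zpow_neg_one]
    norm_num

end ClosedPoint

end WeierstrassCurve

namespace ClosedPoint

variable {k K L : Type*} [Field k] [Field K] [Field L] [Algebra k K] [Algebra k L] [Algebra K L]
  {x : ClosedPoint k K}

theorem IsRamified.chi_eq (h : x.IsRamified L) : x.chi L = 0 := if_pos h

theorem IsSplit.chi_eq (h : x.IsSplit L) : x.chi L = 1 := by
  rw [chi, if_neg h.not_isRamified, if_pos h]

/-- `chi` tests `IsSplit` before `IsInert`, and the two definitions do not formally exclude each
other, hence the second hypothesis. -/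
theorem IsInert.chi_eq (h : x.IsInert L) (h' : ¬ x.IsSplit L) : x.chi L = -1 := by
  rw [chi, if_neg h.1, if_neg h', if_pos h]

end ClosedPoint
end

/-! ### Euler factors and the counting of formal sums. -/

noncomputable section

/-- The local factor `∑ cᵃ Xᵃᵈ = 1 / (1 - c Xᵈ)` of an Euler product. -/
def eulerFactor (d : ℕ) (c : ℤ) : PowerSeries ℤ :=
  PowerSeries.mk fun m => if d ∣ m then c ^ (m / d) else 0

theorem eulerFactor_mul {d : ℕ} (hd : 0 < d) (c : ℤ) :
    eulerFactor d c * (1 - PowerSeries.C c * PowerSeries.X ^ d) = 1 := by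
  ext m
  rw [mul_sub, mul_one, ← mul_assoc, mul_comm _ (PowerSeries.C c), map_sub,
    mul_assoc, PowerSeries.coeff_C_mul, PowerSeries.coeff_mul_X_pow', PowerSeries.coeff_one]
  simp only [eulerFactor, PowerSeries.coeff_mk]
  rcases eq_or_ne m 0 with rfl | hm
  · simp [hd.ne']
  rw [if_neg hm]
  by_cases hdm : d ∣ m
  · obtain ⟨a, rfl⟩ := hdm
    obtain ⟨a, rfl⟩ : ∃ b, a = b + 1 :=
      Nat.exists_eq_succ_of_ne_zero (by rintro rfl; simp at hm)
    have h1 : d * (a + 1) - d = d * a := by rw [mul_add, mul_one, Nat.add_sub_cancel]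
    rw [if_pos (dvd_mul_right _ _), if_pos (Nat.le_mul_of_pos_right _ (Nat.succ_pos a)), h1,
      if_pos (dvd_mul_right _ _), Nat.mul_div_cancel_left _ hd, Nat.mul_div_cancel_left _ hd]
    ring
  · rw [if_neg hdm]
    split_ifs with h1 h2
    · exact absurd ((Nat.dvd_sub_iff_left h1 dvd_rfl).1 h2) hdm
    · simp
    · simp

theorem eulerFactor_eq_of_mul_eq_one {d : ℕ} (hd : 0 < d) {c : ℤ} {f : PowerSeries ℤ}
    (h : f * (1 - PowerSeries.C c * PowerSeries.X ^ d) = 1) : f = eulerFactor d c := by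
  have h' := eulerFactor_mul hd c
  rw [mul_comm] at h'
  exact left_inv_eq_right_inv h h'

theorem eulerFactor_zero {d : ℕ} (hd : 0 < d) : eulerFactor d 0 = 1 :=
  (eulerFactor_eq_of_mul_eq_one hd (by simp)).symm

/-- This is 1 - X^(2d) = (1 - X^d)(1 + X^d), the identity behind the inert points. -/
theorem eulerFactor_two_mul {d : ℕ} (hd : 0 < d) :
    eulerFactor (2 * d) 1 = eulerFactor d 1 * eulerFactor d (-1) := by
  refine (eulerFactor_eq_of_mul_eq_one (by omega) ?_).symm
  have h1 := eulerFactor_mul hd 1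
  have h2 := eulerFactor_mul hd (-1)
  rw [map_one, one_mul] at h1 ⊢
  rw [map_neg, map_one] at h2
  calc _ = (eulerFactor d 1 * (1 - PowerSeries.X ^ d)) *
        (eulerFactor d (-1) * (1 - (-1) * PowerSeries.X ^ d)) := by ring
    _ = 1 := by rw [h1, h2, one_mul]

section Cycles

variable {ι : Type*} {d : ι → ℕ} (c : ι → ℤ) {n : ℕ} {S : Finset ι}

/-- Multiplication of the coefficients of a formal sum by given weights. -/
def weightedFinsupp (d : ι → ℕ) (α : ι →₀ ℕ) : ι →₀ ℕ :=
  Finsupp.onFinset α.support (fun i => α i * d i)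
    fun _ hi => Finsupp.mem_support_iff.2 (left_ne_zero_of_mul hi)

theorem weightedFinsupp_injective (hd : ∀ i, 0 < d i) : Function.Injective (weightedFinsupp d) :=
  fun _ _ h => Finsupp.ext fun i => Nat.eq_of_mul_eq_mul_right (hd i) (DFunLike.congr_fun h i)

theorem support_subset_of_sum_eq (hS : ∀ i, d i ≤ n → i ∈ S) {α : ι →₀ ℕ}
    (hα : (α.sum fun i a => a * d i) = n) : α.support ⊆ S := by
  intro i hi
  apply hS
  have h0 : 0 < α i := Nat.pos_of_ne_zero (Finsupp.mem_support_iff.1 hi)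
  calc d i ≤ α i * d i := Nat.le_mul_of_pos_left _ h0
    _ ≤ α.sum fun i a => a * d i := 
      Finset.single_le_sum (f := fun i => α i * d i) (fun _ _ => Nat.zero_le _) hi
    _ = n := hα

theorem weightedFinsupp_mem_finsuppAntidiag (hS : ∀ i, d i ≤ n → i ∈ S)
    {α : ι →₀ ℕ} (hα : (α.sum fun i a => a * d i) = n) :
    weightedFinsupp d α ∈ S.finsuppAntidiag n := by
  have hsub := support_subset_of_sum_eq hS hα
  rw [Finset.mem_finsuppAntidiag]
  refine ⟨?_, Finsupp.support_onFinset_subset.trans hsub⟩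
  rw [← hα, Finsupp.sum_of_support_subset _ hsub (fun i a => a * d i) fun i _ => zero_mul _]
  rfl

theorem finite_setOf_sum_eq (hd : ∀ i, 0 < d i) (hS : ∀ i, d i ≤ n → i ∈ S) :
    {α : ι →₀ ℕ | (α.sum fun i a => a * d i) = n}.Finite :=
  Set.Finite.of_injOn (f := weightedFinsupp d) (t := S.finsuppAntidiag n)
    (fun _ hα => weightedFinsupp_mem_finsuppAntidiag hS hα)
    (weightedFinsupp_injective hd).injOn (Finset.finite_toSet _)

/-- In the expanded product a choice of exponents l contributes only if every d i divides l i, and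
then l comes from exactly one formal sum. Indices with d i > n cannot occur in degree n, so a finite
S containing all the others is enough. -/
theorem finsum_eq_coeff_prod_eulerFactor (hd : ∀ i, 0 < d i) (hS : ∀ i, d i ≤ n → i ∈ S) :
    (∑ᶠ α ∈ {α : ι →₀ ℕ | (α.sum fun i a => a * d i) = n}, α.prod fun i a => c i ^ a) =
      PowerSeries.coeff n (∏ i ∈ S, eulerFactor (d i) (c i)) := by
  have hfin := finite_setOf_sum_eq hd hS
  rw [finsum_mem_eq_finite_toFinset_sum _ hfin, PowerSeries.coeff_prod]
  refine Finset.sum_bij_ne_zero (fun α _ _ => weightedFinsupp d α) ?_ ?_ ?_ ?_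
  · intro α hα _
    exact weightedFinsupp_mem_finsuppAntidiag hS (hfin.mem_toFinset.1 hα)
  · intro α _ _ β _ _ h
    exact weightedFinsupp_injective hd h
  · intro l hl hne
    rw [Finset.mem_finsuppAntidiag] at hl
    have hdvd : ∀ i, d i ∣ l i := by
      intro i
      by_cases hi : i ∈ S
      · by_contra hcon
        apply hne
        refine Finset.prod_eq_zero hi ?_
        rw [eulerFactor, PowerSeries.coeff_mk, if_neg hcon]
      · rw [Finsupp.notMem_support_iff.1 fun h => hi (hl.2 h)]
        exact dvd_zero _
    let α : ι →₀ ℕ := Finsupp.onFinset l.support (fun i => l i / d i) fun i hi =>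
      Finsupp.mem_support_iff.2 fun h => hi (by rw [h, Nat.zero_div])
    have hαl : weightedFinsupp d α = l := Finsupp.ext fun i => Nat.div_mul_cancel (hdvd i)
    have hαS : α.support ⊆ S := Finsupp.support_onFinset_subset.trans hl.2
    have hα : (α.sum fun i a => a * d i) = n := by
      rw [← hl.1, Finsupp.sum_of_support_subset _ hαS (fun i a => a * d i) fun i _ => zero_mul _]
      exact Finset.sum_congr rfl fun i _ => Nat.div_mul_cancel (hdvd i)
    refine ⟨α, hfin.mem_toFinset.2 hα, ?_, hαl⟩
    rw [Finsupp.prod_of_support_subset _ hαS _ fun i _ => pow_zero _]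
    convert hne using 1
    refine Finset.prod_congr rfl fun i _ => ?_
    rw [eulerFactor, PowerSeries.coeff_mk, if_pos (hdvd i)]
    rfl
  · intro α hα _
    rw [Finsupp.prod_of_support_subset _
      (support_subset_of_sum_eq hS (hfin.mem_toFinset.1 hα)) _ fun i _ => pow_zero _]
    refine Finset.prod_congr rfl fun i _ => ?_
    rw [eulerFactor, PowerSeries.coeff_mk]
    change _ = if d i ∣ α i * d i then c i ^ (α i * d i / d i) else 0
    rw [if_pos (dvd_mul_left _ _), Nat.mul_div_cancel _ (hd i)]

theorem card_eq_coeff_prod_eulerFactor (hd : ∀ i, 0 < d i) (hS : ∀ i, d i ≤ n → i ∈ S) :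
    (Nat.card {α : ι →₀ ℕ | (α.sum fun i a => a * d i) = n} : ℤ) =
      PowerSeries.coeff n (∏ i ∈ S, eulerFactor (d i) 1) := by
  rw [← finsum_eq_coeff_prod_eulerFactor (fun _ => 1) hd hS,
    finsum_mem_eq_finite_toFinset_sum _ (finite_setOf_sum_eq hd hS)]
  simp only [one_pow, Finsupp.prod_fun_one, Finset.sum_const, nsmul_eq_mul, mul_one]
  rw [Nat.card_coe_set_eq, Set.ncard_eq_toFinset_card _ (finite_setOf_sum_eq hd hS)]

end Cycles

theorem Polynomial.card_monic_natDegree_eq (F : Type*) [Field F] [Finite F] (n : ℕ) :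
    Nat.card {f : F[X] // f.Monic ∧ f.natDegree = n} = Nat.card F ^ n := by
  rw [Nat.card_congr ((Polynomial.monicEquivDegreeLT n).trans
    (Polynomial.degreeLTEquiv F n).toEquiv), Nat.card_fun, Nat.card_fin]

/-- The monic polynomials of bounded degree, sorted by their degree. -/
def Polynomial.monicNatDegreeLeEquiv (F : Type*) [Field F] (n : ℕ) :
    {f : F[X] // f.Monic ∧ f.natDegree ≤ n} ≃
      Σ l : Fin (n + 1), {f : F[X] // f.Monic ∧ f.natDegree = l} where
  toFun f := ⟨⟨f.1.natDegree, Nat.lt_succ_of_le f.2.2⟩, f.1, f.2.1, rfl⟩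
  invFun s := ⟨s.2.1, s.2.2.1, s.2.2.2.trans_le (Nat.le_of_lt_succ s.1.2)⟩
  left_inv _ := rfl
  right_inv := by
    rintro ⟨⟨l, hl⟩, f, hf, rfl : f.natDegree = l⟩
    rfl

instance Polynomial.finite_monic_natDegree_eq (F : Type*) [Field F] [Finite F] (n : ℕ) :
    Finite {f : F[X] // f.Monic ∧ f.natDegree = n} :=
  Finite.of_equiv _ ((Polynomial.monicEquivDegreeLT n).trans
    (Polynomial.degreeLTEquiv F n).toEquiv).symm

instance Polynomial.finite_monic_natDegree_le (F : Type*) [Field F] [Finite F] (n : ℕ) :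
    Finite {f : F[X] // f.Monic ∧ f.natDegree ≤ n} :=
  Finite.of_equiv _ (Polynomial.monicNatDegreeLeEquiv F n).symm

theorem Polynomial.card_monic_natDegree_le (F : Type*) [Field F] [Finite F] (n : ℕ) :
    Nat.card {f : F[X] // f.Monic ∧ f.natDegree ≤ n} =
      ∑ l ∈ Finset.range (n + 1), Nat.card F ^ l := by
  rw [Nat.card_congr (Polynomial.monicNatDegreeLeEquiv F n), Nat.card_sigma]
  simp only [Polynomial.card_monic_natDegree_eq]
  rw [Finset.sum_range]
end

/-! ### Effective cycles on the projective line and monic polynomials. -/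

noncomputable section

namespace ClosedPoint

variable {F : Type*} [Field F] {x : ClosedPoint F (RatFunc F)}

/-- The monic irreducible polynomial of a closed point of the affine line, and `1` for the point at
infinity. -/
def poly (x : ClosedPoint F (RatFunc F)) : F[X] :=
  if h : x.localRing.valuation RatFunc.X ≤ 1 then (exists_monic_isZeroOf h).choose else 1

theorem poly_spec (h : x.localRing.valuation RatFunc.X ≤ 1) :
    x.poly.Monic ∧ Irreducible x.poly ∧ x.IsZeroOf x.poly := by
  rw [poly, dif_pos h]
  exact (exists_monic_isZeroOf h).choose_spec

theorem poly_eq_one (h : 1 < x.localRing.valuation RatFunc.X) : x.poly = 1 :=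
  dif_neg (not_le.2 h)

theorem IsZeroOf.poly_eq {p : F[X]} (h : x.IsZeroOf p) (hp : Irreducible p) (hm : p.Monic) :
    x.poly = p := by
  obtain ⟨h1, h2, h3⟩ := poly_spec h.valuation_X_le_one
  exact Polynomial.eq_of_monic_of_associated h1 hm (associated_of_dvd_dvd (h3.dvd h2 h) (h.dvd hp
    h3))

theorem monic_poly (x : ClosedPoint F (RatFunc F)) : x.poly.Monic := by
  rcases le_or_gt (x.localRing.valuation RatFunc.X) 1 with h | h
  · exact (poly_spec h).1
  · rw [poly_eq_one h]; exact Polynomial.monic_one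

theorem degree_eq_natDegree_poly (h : x.localRing.valuation RatFunc.X ≤ 1) :
    x.degree = x.poly.natDegree :=
  (poly_spec h).2.2.degree_eq (poly_spec h).2.1

theorem natDegree_poly_le (x : ClosedPoint F (RatFunc F)) : x.poly.natDegree ≤ x.degree := by
  rcases le_or_gt (x.localRing.valuation RatFunc.X) 1 with h | h
  · exact (degree_eq_natDegree_poly h).ge
  · rw [poly_eq_one h, Polynomial.natDegree_one]; exact Nat.zero_le _

theorem degree_pos (x : ClosedPoint F (RatFunc F)) : 0 < x.degree := by
  rcases le_or_gt (x.localRing.valuation RatFunc.X) 1 with h | h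
  · rw [degree_eq_natDegree_poly h]
    exact (poly_spec h).2.1.natDegree_pos
  · rw [degree_eq_one_of_one_lt_valuation_X h]; exact one_pos

theorem poly_injective : Function.Injective (poly (F := F)) := by
  intro x y hxy
  rcases le_or_gt (x.localRing.valuation RatFunc.X) 1 with hx | hx <;>
    rcases le_or_gt (y.localRing.valuation RatFunc.X) 1 with hy | hy
  · exact (poly_spec hx).2.2.unique (poly_spec hx).2.1 (hxy ▸ (poly_spec hy).2.2)
  · rw [poly_eq_one hy] at hxy
    exact absurd (hxy ▸ (poly_spec hx).2.1) not_irreducible_one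
  · rw [poly_eq_one hx] at hxy
    exact absurd (hxy ▸ (poly_spec hy).2.1) not_irreducible_one
  · exact eq_of_one_lt_valuation_X hx hy

theorem finite_setOf_degree_le [Finite F] (n : ℕ) :
    {x : ClosedPoint F (RatFunc F) | x.degree ≤ n}.Finite :=
  Set.Finite.of_injOn (f := poly) (t := {f : F[X] | f.Monic ∧ f.natDegree ≤ n})
    (fun x hx => ⟨x.monic_poly, x.natDegree_poly_le.trans hx⟩) poly_injective.injOn
    (Polynomial.finite_monic_natDegree_le F n)

theorem valuation_poly_eq_one {y : ClosedPoint F (RatFunc F)}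
    (h : x.localRing.valuation RatFunc.X ≤ 1) (hne : y ≠ x) :
    x.localRing.valuation (algebraMap F[X] (RatFunc F) y.poly) = 1 := by
  obtain ⟨h1, h2, h3⟩ := poly_spec h
  rw [h3.valuation_eq_one_iff h2]
  intro hdvd
  rcases le_or_gt (y.localRing.valuation RatFunc.X) 1 with hy | hy
  · have := h2.associated_of_dvd (poly_spec hy).2.1 hdvd
    exact hne (poly_injective (Polynomial.eq_of_monic_of_associated h1 (poly_spec hy).1 this)).symm
  · rw [poly_eq_one hy] at hdvd
    exact h2.not_isUnit (isUnit_of_dvd_one hdvd)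

end ClosedPoint

namespace EffectiveCycle

open ClosedPoint

variable {F : Type*} [Field F]

/-- The monic polynomial whose divisor of zeros is the affine part of an effective cycle. -/
def poly (α : EffectiveCycle F (RatFunc F)) : F[X] := α.prod fun x a => x.poly ^ a

theorem poly_add (α β : EffectiveCycle F (RatFunc F)) : (α + β).poly = α.poly * β.poly :=
  Finsupp.prod_add_index' (fun _ => pow_zero _) fun _ _ _ => pow_add _ _ _

theorem poly_single (x : ClosedPoint F (RatFunc F)) (n : ℕ) :
    poly (Finsupp.single x n) = x.poly ^ n :=
  Finsupp.prod_single_index (pow_zero _)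

theorem degree_add (α β : EffectiveCycle F (RatFunc F)) :
    EffectiveCycle.degree (α + β) = α.degree + β.degree :=
  Finsupp.sum_add_index' (fun _ => zero_mul _) fun _ _ _ => add_mul _ _ _

theorem degree_single (x : ClosedPoint F (RatFunc F)) (n : ℕ) :
    EffectiveCycle.degree (Finsupp.single x n) = n * x.degree :=
  Finsupp.sum_single_index (zero_mul _)

theorem monic_poly (α : EffectiveCycle F (RatFunc F)) : α.poly.Monic :=
  Polynomial.monic_prod_of_monic _ _ fun x _ => x.monic_poly.pow _

theorem valuation_poly (α : EffectiveCycle F (RatFunc F)) {x : ClosedPoint F (RatFunc F)}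
    (h : x.localRing.valuation RatFunc.X ≤ 1) :
    x.localRing.valuation (algebraMap F[X] (RatFunc F) α.poly) =
      x.localRing.valuation (algebraMap F[X] (RatFunc F) x.poly) ^ α x := by
  rw [poly, Finsupp.prod, map_prod, map_prod, Finset.prod_eq_single x]
  · rw [map_pow, map_pow]
  · intro y _ hne
    rw [map_pow, map_pow, valuation_poly_eq_one h hne, one_pow]
  · intro hx
    rw [Finsupp.notMem_support_iff.1 hx, pow_zero, map_one, map_one]

/-- Here x is infinity: its polynomial is 1 and its degree is 1, so its multiplicity is exactly what
the polynomial does not see. -/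
theorem natDegree_poly_add {x : ClosedPoint F (RatFunc F)}
    (h : 1 < x.localRing.valuation RatFunc.X) (α : EffectiveCycle F (RatFunc F)) :
    α.poly.natDegree + α x = α.degree := by
  induction α using Finsupp.induction_linear with
  | zero => simp [poly, degree]
  | add α β hα hβ =>
    rw [poly_add, degree_add,
      (EffectiveCycle.monic_poly α).natDegree_mul (EffectiveCycle.monic_poly β), Finsupp.add_apply, ← hα, ← hβ]
    ring
  | single y n =>
    rw [poly_single, degree_single, y.monic_poly.natDegree_pow]
    rcases le_or_gt (y.localRing.valuation RatFunc.X) 1 with hy | hy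
    · have hne : y ≠ x := by rintro rfl; exact absurd h (not_lt.2 hy)
      rw [Finsupp.single_eq_of_ne hne.symm, degree_eq_natDegree_poly hy, add_zero]
    · obtain rfl := eq_of_one_lt_valuation_X h hy
      rw [Finsupp.single_eq_same, poly_eq_one h, degree_eq_one_of_one_lt_valuation_X h]
      simp

theorem exists_poly_eq (f : F[X]) (hf : f.Monic) :
    ∃ α : EffectiveCycle F (RatFunc F), α.poly = f ∧ α.degree = f.natDegree := by
  induction hn : f.natDegree using Nat.strong_induction_on generalizing f with
  | _ n ih =>
  by_cases hu : IsUnit f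
  · obtain rfl := hf.eq_one_of_isUnit hu
    exact ⟨0, by simp [poly], by simpa [degree] using hn⟩
  obtain ⟨p, hpm, hp, g, rfl⟩ := Polynomial.exists_monic_irreducible_factor f hu
  have hg : g.Monic := hpm.of_mul_monic_left hf
  rw [hpm.natDegree_mul hg] at hn
  have hpos := hp.natDegree_pos
  obtain ⟨α, hα, hαd⟩ := ih g.natDegree (by omega) g hg rfl
  obtain ⟨x, hx⟩ := ClosedPoint.exists_isZeroOf hp
  refine ⟨Finsupp.single x 1 + α, ?_, ?_⟩
  · rw [poly_add, poly_single, hx.poly_eq hp hpm, pow_one, hα]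
  · rw [degree_add, degree_single, one_mul, hx.degree_eq hp, hαd, hn]

theorem card_degree_eq [Finite F] (n : ℕ) :
    Nat.card {α : EffectiveCycle F (RatFunc F) | α.degree = n} =
      ∑ l ∈ Finset.range (n + 1), Nat.card F ^ l := by
  rw [← Polynomial.card_monic_natDegree_le]
  obtain ⟨x, hx⟩ := ClosedPoint.exists_one_lt_valuation_X (F := F)
  refine Nat.card_eq_of_bijective (fun α => ⟨α.1.poly, α.1.monic_poly, ?_⟩) ⟨?_, ?_⟩
  · have := natDegree_poly_add hx α.1
    rw [show EffectiveCycle.degree α.1 = n from α.2] at this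
    omega
  · rintro ⟨α, hα⟩ ⟨β, hβ⟩ h
    replace h : α.poly = β.poly := congrArg Subtype.val h
    refine Subtype.ext (Finsupp.ext fun y => ?_)
    change α y = β y
    rcases le_or_gt (y.localRing.valuation RatFunc.X) 1 with hy | hy
    · have h1 := α.valuation_poly hy
      rw [h, β.valuation_poly hy] at h1
      have hu := (poly_spec hy).2.2.isUniformizer (poly_spec hy).2.1
      exact (pow_right_strictAnti₀ hu.val_pos hu.lt_one).injective h1.symm
    · have h1 := natDegree_poly_add hy α
      have h2 := natDegree_poly_add hy β
      rw [show EffectiveCycle.degree α = n from hα] at h1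
      rw [show EffectiveCycle.degree β = n from hβ, ← h] at h2
      omega
  · rintro ⟨f, hf, hfn⟩
    obtain ⟨α, rfl, hα⟩ := exists_poly_eq f hf
    -- The point at infinity fills the degree up to n without changing the polynomial.
    refine ⟨⟨α + Finsupp.single x (n - EffectiveCycle.degree α), ?_⟩, Subtype.ext ?_⟩
    · change EffectiveCycle.degree _ = n
      rw [degree_add, degree_single, degree_eq_one_of_one_lt_valuation_X hx]
      omega
    · change poly _ = α.poly
      rw [poly_add, poly_single, poly_eq_one hx, one_pow, mul_one]

end EffectiveCycle
end

/-! ### Stable multisets as formal sums of orbits, and facts from Galois theory. -/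

noncomputable section

namespace MulAction

variable {G X : Type*} [Group G] [MulAction G X]

/-- The multiset of points attached to a formal sum of finite orbits. -/
def orbitMultiset (hfin : ∀ o : orbitRel.Quotient G X, o.orbit.Finite)
    (α : orbitRel.Quotient G X →₀ ℕ) : Multiset X :=
  ∑ o ∈ α.support, α o • (hfin o).toFinset.val

section Finite

variable (hfin : ∀ o : orbitRel.Quotient G X, o.orbit.Finite)

theorem count_orbitMultiset (α : orbitRel.Quotient G X →₀ ℕ) (P : X) :
    (orbitMultiset hfin α).count P = α (Quotient.mk _ P) := by
  have key : ∀ o : orbitRel.Quotient G X, (hfin o).toFinset.val.count P =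
      if o = Quotient.mk _ P then 1 else 0 := by
    intro o
    rw [Multiset.count_eq_of_nodup (Finset.nodup _)]
    refine if_congr ?_ rfl rfl
    rw [Finset.mem_val, Set.Finite.mem_toFinset, orbitRel.Quotient.mem_orbit]
    exact eq_comm
  rw [orbitMultiset, Multiset.count_sum']
  simp only [Multiset.count_nsmul, key, mul_ite, mul_one, mul_zero, Finset.sum_ite_eq']
  split_ifs with h
  · rfl
  · exact (Finsupp.notMem_support_iff.1 h).symm

theorem card_orbitMultiset (α : orbitRel.Quotient G X →₀ ℕ) :
    (orbitMultiset hfin α).card = α.sum fun o a => a * o.orbit.ncard := by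
  rw [orbitMultiset, Multiset.card_sum, Finsupp.sum]
  refine Finset.sum_congr rfl fun o _ => ?_
  rw [Multiset.card_nsmul, Finset.card_val, Set.ncard_eq_toFinset_card _ (hfin o)]

theorem map_smul_eq_iff (s : Multiset X) (g : G) :
    s.map (g • ·) = s ↔ ∀ P, s.count (g • P) = s.count P := by
  have h : ∀ P, (s.map (g • ·)).count (g • P) = s.count P := fun P =>
    Multiset.count_map_eq_count' (g • ·) s (MulAction.injective g) P
  constructor
  · intro e P
    rw [← h P, e]
  · intro e
    ext P
    rw [← smul_inv_smul g P, h, e]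

/-- Stability makes the multiplicity constant on orbits, so the coefficient of an orbit can be read
at any representative. -/
theorem exists_orbitMultiset_eq {s : Multiset X} (hs : ∀ g : G, s.map (g • ·) = s) :
    ∃ α, orbitMultiset hfin α = s := by
  have hc : ∀ (g : G) (P : X), s.count (g • P) = s.count P := fun g =>
    (map_smul_eq_iff s g).1 (hs g)
  have hout : ∀ P : X, s.count (Quotient.out (Quotient.mk (orbitRel G X) P)) = s.count P := by
    intro P
    obtain ⟨g, hg⟩ : Quotient.out (Quotient.mk (orbitRel G X) P) ∈ orbit G P :=
      orbitRel_apply.1 (Quotient.mk_out P)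
    rw [← hg]
    exact hc g P
  refine ⟨Finsupp.onFinset (s.toFinset.image (Quotient.mk (orbitRel G X)))
    (fun o => s.count o.out) fun o ho => ?_, ?_⟩
  · exact Finset.mem_image.2 ⟨o.out, Multiset.mem_toFinset.2 (Multiset.count_ne_zero.1 ho),
      Quotient.out_eq o⟩
  · ext P
    rw [count_orbitMultiset]
    exact hout P

theorem map_smul_orbitMultiset (α : orbitRel.Quotient G X →₀ ℕ) (g : G) :
    (orbitMultiset hfin α).map (g • ·) = orbitMultiset hfin α := by
  rw [map_smul_eq_iff]
  intro P
  rw [count_orbitMultiset, count_orbitMultiset]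
  exact congrArg _ (Quotient.sound (orbitRel_apply.2 ⟨g, rfl⟩))

end Finite

/-- The multisets of `n` points stable under a group action with finite orbits correspond to the
formal sums of orbits of degree `n`. -/
def symStableEquiv (hfin : ∀ o : orbitRel.Quotient G X, o.orbit.Finite) (n : ℕ) :
    {α : orbitRel.Quotient G X →₀ ℕ | (α.sum fun o a => a * o.orbit.ncard) = n} ≃
      {s : Sym X n // ∀ g : G, s.map (g • ·) = s} := by
  refine Equiv.ofBijective (fun α => ⟨⟨orbitMultiset hfin α.1,
    (card_orbitMultiset hfin α.1).trans α.2⟩,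
    fun g => Subtype.ext (map_smul_orbitMultiset hfin α.1 g)⟩) ⟨?_, ?_⟩
  · intro α β h
    have h' : orbitMultiset hfin α.1 = orbitMultiset hfin β.1 :=
      congrArg (fun s => (s.1 : Multiset X)) h
    refine Subtype.ext (Finsupp.ext fun o => ?_)
    obtain ⟨P, rfl⟩ := Quotient.exists_rep o
    rw [← count_orbitMultiset hfin, h', count_orbitMultiset]
  · rintro ⟨⟨s, hsn⟩, hs⟩
    obtain ⟨α, hα⟩ := exists_orbitMultiset_eq hfin (s := s) fun g => congrArg Subtype.val (hs g)
    refine ⟨⟨α, ?_⟩, Subtype.ext (Subtype.ext hα)⟩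
    change _ = n
    rw [← card_orbitMultiset hfin, hα, hsn]

end MulAction

section Galois

variable {F : Type*} [Field F] {E : Type*} [Field E] [Algebra F E]

/-- By the Galois correspondence y lies in F(x), and F(x) = F[x] since x is algebraic. -/
theorem exists_aeval_eq_of_forall_algEquiv [IsGalois F E] (x y : E)
    (h : ∀ σ : E ≃ₐ[F] E, σ x = x → σ y = y) : ∃ r : F[X], y = Polynomial.aeval x r := by
  have hx : IsIntegral F x := Algebra.IsIntegral.isIntegral x
  have hy : y ∈ IntermediateField.adjoin F {x} := by
    rw [← InfiniteGalois.fixedField_fixingSubgroup (IntermediateField.adjoin F {x}),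
      IntermediateField.mem_fixedField_iff]
    intro σ hσ
    exact h σ ((IntermediateField.mem_fixingSubgroup_iff _ σ).1 hσ x
      (IntermediateField.mem_adjoin_simple_self F x))
  rw [← IntermediateField.mem_toSubalgebra,
    IntermediateField.adjoin_simple_toSubalgebra_of_isAlgebraic hx.isAlgebraic,
    Algebra.adjoin_singleton_eq_range_aeval] at hy
  obtain ⟨r, hr⟩ := hy
  exact ⟨r, hr.symm⟩

theorem Irreducible.exists_algEquiv_of_aeval_eq_zero [Normal F E] {p : F[X]} (hp : Irreducible p)
    {x x' : E} (hx : Polynomial.aeval x p = 0) (hx' : Polynomial.aeval x' p = 0) :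
    ∃ σ : E ≃ₐ[F] E, σ x = x' :=
  minpoly.exists_algEquiv_of_root (Normal.isIntegral inferInstance x').isAlgebraic
    ((hp.dvd_iff_aeval_eq_zero hx).2 ((hp.dvd_iff_aeval_eq_zero hx').1 (minpoly.aeval F x')))

end Galois
end

/-! ### Galois action on the geometric fibres of the double cover. -/

noncomputable section

namespace WeierstrassCurve

open MulAction

variable {F : Type*} [Field F] (W : WeierstrassCurve F)

/-- The points of `W` over the algebraic closure. -/
abbrev GeomPoint : Type _ := (W.baseChange (AlgebraicClosure F)).toAffine.Point

/-- The absolute Galois group acts on the points over the algebraic closure. -/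
instance : MulAction (AlgebraicClosure F ≃ₐ[F] AlgebraicClosure F) W.GeomPoint where
  smul σ P := Affine.Point.map (W' := W.toAffine) σ.toAlgHom P
  one_smul P := by cases P <;> rfl
  mul_smul σ τ P := by cases P <;> rfl

variable {W}

theorem equation_algEquiv (σ : AlgebraicClosure F ≃ₐ[F] AlgebraicClosure F)
    {x y : AlgebraicClosure F}
    (h : y ^ 2 + Polynomial.aeval x W.yCoeff * y + Polynomial.aeval x W.oneCoeff = 0) :
    σ y ^ 2 + Polynomial.aeval (σ x) W.yCoeff * σ y + Polynomial.aeval (σ x) W.oneCoeff = 0 := by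
  have := congrArg σ h
  rwa [map_zero, map_add, map_add, map_mul, map_pow, ← Polynomial.aeval_algHom_apply,
    ← Polynomial.aeval_algHom_apply] at this

theorem exists_geomPoint (x : AlgebraicClosure F) : ∃ y : AlgebraicClosure F,
    y ^ 2 + Polynomial.aeval x W.yCoeff * y + Polynomial.aeval x W.oneCoeff = 0 := by
  let f : (AlgebraicClosure F)[X] := Polynomial.X ^ 2 +
    Polynomial.C (Polynomial.aeval x W.yCoeff) * Polynomial.X +
    Polynomial.C (Polynomial.aeval x W.oneCoeff)
  have hf : f.degree = 2 := by simp only [f]; compute_degree!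
  obtain ⟨y, hy⟩ := IsAlgClosed.exists_root f (by rw [hf]; decide)
  exact ⟨y, by simpa [f] using hy⟩

theorem eq_or_eq_of_equation {E : Type*} [Field E] {s t y y' : E} (h : y ^ 2 + s * y + t = 0)
    (h' : y' ^ 2 + s * y' + t = 0) : y' = y ∨ y' = -s - y := by
  have : (y' - y) * (y' - (-s - y)) = 0 := by linear_combination h' - h
  rcases mul_eq_zero.1 this with e | e
  · exact Or.inl (sub_eq_zero.1 e)
  · exact Or.inr (sub_eq_zero.1 e)

theorem aeval_subst (x : AlgebraicClosure F) (r : F[X]) : Polynomial.aeval x (W.subst r) =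
    Polynomial.aeval x r ^ 2 + Polynomial.aeval x W.yCoeff * Polynomial.aeval x r +
      Polynomial.aeval x W.oneCoeff := by
  simp [subst]

theorem dvd_subst_conj {p r : F[X]} (hr : p ∣ W.subst r) : p ∣ W.subst (-W.yCoeff - r) := by
  convert hr using 1
  simp only [subst]
  ring

/-- If every automorphism fixing x also fixed y, then y = r(x) for a polynomial r, and r would be a
root modulo p. The clause σ y ≠ y shows that the two roots over x are distinct, which the equation
alone does not guarantee. -/
theorem exists_algEquiv_conj [Finite F] {p : F[X]} (hp : Irreducible p)
    (hr : ∀ r, ¬ p ∣ W.subst r) {x y : AlgebraicClosure F} (hx : Polynomial.aeval x p = 0)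
    (h : y ^ 2 + Polynomial.aeval x W.yCoeff * y + Polynomial.aeval x W.oneCoeff = 0) :
    ∃ σ : AlgebraicClosure F ≃ₐ[F] AlgebraicClosure F, σ x = x ∧
      σ y = -Polynomial.aeval x W.yCoeff - y ∧ σ y ≠ y := by
  by_contra! hcon
  obtain ⟨r, rfl⟩ := exists_aeval_eq_of_forall_algEquiv (F := F) x y fun σ hσ => by
    have h' := equation_algEquiv σ h
    rw [hσ] at h'
    rcases eq_or_eq_of_equation h h' with e | e
    · exact e
    · exact hcon σ hσ e
  apply hr r
  rw [← hp.dvd_iff_aeval_eq_zero hx, aeval_subst, h]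

variable (W) [W.IsElliptic]

/-- The point `(x, y)`. -/
def geomPoint (x y : AlgebraicClosure F)
    (h : y ^ 2 + Polynomial.aeval x W.yCoeff * y + Polynomial.aeval x W.oneCoeff = 0) :
    W.GeomPoint :=
  have : (W.baseChange (AlgebraicClosure F)).toAffine.IsElliptic :=
    inferInstanceAs (W.map _).IsElliptic
  .some x y (Affine.equation_iff_nonsingular.1 ((W.equation_iff_aeval x y).2 h))

variable {W}

theorem geomPoint_inj {x y x' y' : AlgebraicClosure F} {h h'} :
    W.geomPoint x y h = W.geomPoint x' y' h' ↔ x = x' ∧ y = y' := by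
  rw [geomPoint, geomPoint, Affine.Point.some.injEq]

theorem GeomPoint.cases (P : W.GeomPoint) : P = 0 ∨ ∃ x y h, P = W.geomPoint x y h := by
  cases P with
  | zero => exact Or.inl rfl
  | some x y h => exact Or.inr ⟨x, y, (W.equation_iff_aeval x y).1 h.1, rfl⟩

theorem geomPoint_ne_zero {x y : AlgebraicClosure F} {h} : W.geomPoint x y h ≠ 0 :=
  Affine.Point.some_ne_zero _

theorem smul_geomPoint (σ : AlgebraicClosure F ≃ₐ[F] AlgebraicClosure F)
    {x y : AlgebraicClosure F} {h} :
    σ • W.geomPoint x y h = W.geomPoint (σ x) (σ y) (equation_algEquiv σ h) := rfl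

/-- The points of `W` over the algebraic closure that lie over a closed point of the projective
line. -/
def fiber (W : WeierstrassCurve F) [W.IsElliptic] (z : ClosedPoint F (RatFunc F)) :
    Set W.GeomPoint :=
  {P | (P = 0 ∧ 1 < z.localRing.valuation RatFunc.X) ∨
    ∃ x y h, P = W.geomPoint x y h ∧ z.localRing.valuation RatFunc.X ≤ 1 ∧
      Polynomial.aeval x z.poly = 0}

variable {z : ClosedPoint F (RatFunc F)}

theorem zero_mem_fiber : (0 : W.GeomPoint) ∈ W.fiber z ↔ 1 < z.localRing.valuation RatFunc.X := by
  constructor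
  · rintro (h | ⟨x, y, h, e, -⟩)
    · exact h.2
    · exact absurd e.symm geomPoint_ne_zero
  · exact fun h => Or.inl ⟨rfl, h⟩

theorem geomPoint_mem_fiber {x y : AlgebraicClosure F} {h} : W.geomPoint x y h ∈ W.fiber z ↔
    z.localRing.valuation RatFunc.X ≤ 1 ∧ Polynomial.aeval x z.poly = 0 := by
  constructor
  · rintro (h | ⟨x', y', h', e, hz⟩)
    · exact absurd h.1 geomPoint_ne_zero
    · rw [geomPoint_inj] at e
      rwa [e.1]
  · exact fun hz => Or.inr ⟨x, y, h, rfl, hz⟩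

theorem smul_mem_fiber {P : W.GeomPoint} (hP : P ∈ W.fiber z)
    (σ : AlgebraicClosure F ≃ₐ[F] AlgebraicClosure F) : σ • P ∈ W.fiber z := by
  rcases P.cases with rfl | ⟨x, y, h, rfl⟩
  · exact hP
  · rw [geomPoint_mem_fiber] at hP
    rw [smul_geomPoint, geomPoint_mem_fiber]
    refine ⟨hP.1, ?_⟩
    rw [← AlgEquiv.coe_toAlgHom, Polynomial.aeval_algHom_apply, hP.2, map_zero]

theorem exists_mem_fiber (P : W.GeomPoint) : ∃ z, P ∈ W.fiber z := by
  rcases P.cases with rfl | ⟨x, y, h, rfl⟩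
  · obtain ⟨z, hz⟩ := ClosedPoint.exists_one_lt_valuation_X (F := F)
    exact ⟨z, zero_mem_fiber.2 hz⟩
  · have hint : _root_.IsIntegral F x := Algebra.IsIntegral.isIntegral x
    obtain ⟨z, hz⟩ := ClosedPoint.exists_isZeroOf (minpoly.irreducible hint)
    refine ⟨z, geomPoint_mem_fiber.2 ⟨hz.valuation_X_le_one, ?_⟩⟩
    rw [hz.poly_eq (minpoly.irreducible hint) (minpoly.monic hint), minpoly.aeval]

theorem eq_of_mem_fiber {P : W.GeomPoint} {z' : ClosedPoint F (RatFunc F)} (h : P ∈ W.fiber z)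
    (h' : P ∈ W.fiber z') : z = z' := by
  rcases P.cases with rfl | ⟨x, y, hxy, rfl⟩
  · exact ClosedPoint.eq_of_one_lt_valuation_X (zero_mem_fiber.1 h) (zero_mem_fiber.1 h')
  · rw [geomPoint_mem_fiber] at h h'
    obtain ⟨h1, h2, h3⟩ := ClosedPoint.poly_spec h.1
    obtain ⟨h1', h2', h3'⟩ := ClosedPoint.poly_spec h'.1
    apply ClosedPoint.poly_injective
    exact Polynomial.eq_of_monic_of_associated h1 h1' (associated_of_dvd_dvd
      ((h2.dvd_iff_aeval_eq_zero h.2).1 h'.2) ((h2'.dvd_iff_aeval_eq_zero h'.2).1 h.2))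

theorem ncard_rootSet [Finite F] (hz : z.localRing.valuation RatFunc.X ≤ 1) :
    {x : AlgebraicClosure F | Polynomial.aeval x z.poly = 0}.ncard = z.degree := by
  obtain ⟨h1, h2, h3⟩ := ClosedPoint.poly_spec hz
  rw [ClosedPoint.degree_eq_natDegree_poly hz,
    ← Polynomial.card_rootSet_eq_natDegree (K := AlgebraicClosure F)
      (PerfectField.separable_of_irreducible h2) (IsAlgClosed.splits _), ← Nat.card_eq_fintype_card,
    Nat.card_coe_set_eq]
  congr 1
  ext x
  rw [Polynomial.mem_rootSet, Set.mem_ofPred_eq]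
  exact ⟨fun h => ⟨h2.ne_zero, h⟩, fun h => h.2⟩

/-- The points `(x, r(x))` over a closed point of the affine line. -/
def sheet (W : WeierstrassCurve F) [W.IsElliptic] (z : ClosedPoint F (RatFunc F)) (r : F[X]) :
    Set W.GeomPoint :=
  {P | ∃ x h, P = W.geomPoint x (Polynomial.aeval x r) h ∧ Polynomial.aeval x z.poly = 0}

/-- The Galois group is transitive on the roots of an irreducible polynomial, and on a sheet y is a
polynomial in x over F. -/
theorem orbit_eq_sheet (hz : z.localRing.valuation RatFunc.X ≤ 1) {r : F[X]} {P : W.GeomPoint}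
    (hP : P ∈ W.sheet z r) :
    orbit (AlgebraicClosure F ≃ₐ[F] AlgebraicClosure F) P = W.sheet z r := by
  obtain ⟨x, h, rfl, hx⟩ := hP
  have haeval : ∀ (σ : AlgebraicClosure F ≃ₐ[F] AlgebraicClosure F) (f : F[X]),
      σ (Polynomial.aeval x f) = Polynomial.aeval (σ x) f := fun σ f =>
    (Polynomial.aeval_algHom_apply σ.toAlgHom x f).symm
  ext Q
  constructor
  · rintro ⟨σ, rfl⟩
    refine ⟨σ x, by simpa only [haeval] using equation_algEquiv σ h, ?_, ?_⟩
    · change σ • W.geomPoint _ _ _ = _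
      rw [smul_geomPoint, geomPoint_inj]
      exact ⟨rfl, haeval σ r⟩
    · rw [← haeval, hx, map_zero]
  · rintro ⟨x', h', rfl, hx'⟩
    obtain ⟨σ, rfl⟩ :=
      (ClosedPoint.poly_spec hz).2.1.exists_algEquiv_of_aeval_eq_zero hx hx'
    refine ⟨σ, ?_⟩
    change σ • W.geomPoint _ _ _ = _
    rw [smul_geomPoint, geomPoint_inj]
    exact ⟨rfl, haeval σ r⟩

theorem ncard_sheet [Finite F] (hz : z.localRing.valuation RatFunc.X ≤ 1) {r : F[X]}
    (hr : z.poly ∣ W.subst r) : (W.sheet z r).ncard = z.degree := by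
  rw [← ncard_rootSet hz]
  have heq : ∀ x : AlgebraicClosure F, Polynomial.aeval x z.poly = 0 →
      Polynomial.aeval x r ^ 2 + Polynomial.aeval x W.yCoeff * Polynomial.aeval x r +
        Polynomial.aeval x W.oneCoeff = 0 := fun x hx => by
    rw [← aeval_subst]
    exact ((ClosedPoint.poly_spec hz).2.1.dvd_iff_aeval_eq_zero hx).2 hr
  refine (Set.ncard_congr (fun x hx => W.geomPoint x (Polynomial.aeval x r) (heq x hx)) ?_ ?_
    ?_).symm
  · exact fun x hx => ⟨x, heq x hx, rfl, hx⟩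
  · exact fun x x' hx hx' h => (geomPoint_inj.1 h).1
  · rintro P ⟨x, h, rfl, hx⟩
    exact ⟨x, hx, rfl⟩

theorem nonempty_sheet (hz : z.localRing.valuation RatFunc.X ≤ 1) {r : F[X]}
    (hr : z.poly ∣ W.subst r) : (W.sheet z r).Nonempty := by
  have hp := (ClosedPoint.poly_spec hz).2.1
  obtain ⟨x, hx⟩ := IsAlgClosed.exists_aeval_eq_zero (AlgebraicClosure F) z.poly
    (Polynomial.degree_pos_of_irreducible hp).ne'
  exact ⟨_, x, by rw [← aeval_subst]; exact (hp.dvd_iff_aeval_eq_zero hx).2 hr, rfl, hx⟩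

theorem fiber_eq_union_sheet (hz : z.localRing.valuation RatFunc.X ≤ 1) {r : F[X]}
    (hr : z.poly ∣ W.subst r) : W.fiber z = W.sheet z r ∪ W.sheet z (-W.yCoeff - r) := by
  have hp := (ClosedPoint.poly_spec hz).2.1
  ext P
  constructor
  · intro hP
    rcases P.cases with rfl | ⟨x, y, h, rfl⟩
    · exact absurd (zero_mem_fiber.1 hP) (not_lt.2 hz)
    · have hx := (geomPoint_mem_fiber.1 hP).2
      have hr' := (hp.dvd_iff_aeval_eq_zero hx).2 hr
      rw [aeval_subst] at hr'
      rcases eq_or_eq_of_equation hr' h with rfl | rfl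
      · exact Or.inl ⟨x, h, rfl, hx⟩
      · have e : -Polynomial.aeval x W.yCoeff - Polynomial.aeval x r =
            Polynomial.aeval x (-W.yCoeff - r) := by rw [map_sub, map_neg]
        refine Or.inr ⟨x, e ▸ h, ?_, hx⟩
        rw [geomPoint_inj]
        exact ⟨rfl, e⟩
  · rintro (⟨x, h, rfl, hx⟩ | ⟨x, h, rfl, hx⟩) <;> exact geomPoint_mem_fiber.2 ⟨hz, hx⟩

/-- The difference of the roots r and -s - r is 2r + s, so the sheets coincide exactly when the root
is double modulo p. -/
theorem sheet_conj_eq (hz : z.localRing.valuation RatFunc.X ≤ 1) {r : F[X]}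
    (hr : z.poly ∣ 2 * r + W.yCoeff) : W.sheet z (-W.yCoeff - r) = W.sheet z r := by
  have hp := (ClosedPoint.poly_spec hz).2.1
  have e : ∀ x : AlgebraicClosure F, Polynomial.aeval x z.poly = 0 →
      Polynomial.aeval x (-W.yCoeff - r) = Polynomial.aeval x r := fun x hx => by
    have := (hp.dvd_iff_aeval_eq_zero hx).2 hr
    rw [map_add, map_mul, map_ofNat] at this
    rw [map_sub, map_neg]
    linear_combination -this
  ext P
  constructor
  · rintro ⟨x, h, rfl, hx⟩
    exact ⟨x, by rw [← e x hx]; exact h, geomPoint_inj.2 ⟨rfl, e x hx⟩, hx⟩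
  · rintro ⟨x, h, rfl, hx⟩
    exact ⟨x, by rw [e x hx]; exact h, geomPoint_inj.2 ⟨rfl, (e x hx).symm⟩, hx⟩

theorem disjoint_sheet_conj (hz : z.localRing.valuation RatFunc.X ≤ 1) {r : F[X]}
    (hr : ¬ z.poly ∣ 2 * r + W.yCoeff) : Disjoint (W.sheet z r) (W.sheet z (-W.yCoeff - r)) := by
  have hp := (ClosedPoint.poly_spec hz).2.1
  rw [Set.disjoint_left]
  rintro P ⟨x, h, rfl, hx⟩ ⟨x', h', e, hx'⟩
  obtain ⟨rfl, e⟩ := geomPoint_inj.1 e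
  apply hr
  rw [← hp.dvd_iff_aeval_eq_zero hx, map_add, map_mul, map_ofNat]
  rw [map_sub, map_neg] at e
  linear_combination e

/-- One automorphism τ carries x to x'. If it yields the wrong one of the two values of y, it is
first composed with a σ that fixes x and exchanges those values. -/
theorem orbit_eq_fiber [Finite F] (hz : z.localRing.valuation RatFunc.X ≤ 1)
    (hr : ∀ r, ¬ z.poly ∣ W.subst r) {P : W.GeomPoint} (hP : P ∈ W.fiber z) :
    orbit (AlgebraicClosure F ≃ₐ[F] AlgebraicClosure F) P = W.fiber z := by
  have hp := (ClosedPoint.poly_spec hz).2.1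
  rcases P.cases with rfl | ⟨x, y, h, rfl⟩
  · exact absurd (zero_mem_fiber.1 hP) (not_lt.2 hz)
  have hx := (geomPoint_mem_fiber.1 hP).2
  ext Q
  constructor
  · rintro ⟨σ, rfl⟩
    exact smul_mem_fiber hP σ
  · intro hQ
    rcases Q.cases with rfl | ⟨x', y', h', rfl⟩
    · exact absurd (zero_mem_fiber.1 hQ) (not_lt.2 hz)
    obtain ⟨τ, rfl⟩ := hp.exists_algEquiv_of_aeval_eq_zero hx (geomPoint_mem_fiber.1 hQ).2
    rcases eq_or_eq_of_equation (equation_algEquiv τ h) h' with rfl | rfl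
    · exact ⟨τ, rfl⟩
    · obtain ⟨σ, hσx, hσy, -⟩ := exists_algEquiv_conj hp hr hx h
      refine ⟨τ * σ, ?_⟩
      change (τ * σ) • W.geomPoint _ _ _ = _
      rw [smul_geomPoint, geomPoint_inj, AlgEquiv.mul_apply, AlgEquiv.mul_apply, hσx, hσy, map_sub,
        map_neg]
      refine ⟨rfl, ?_⟩
      congr 2
      exact (Polynomial.aeval_algHom_apply τ.toAlgHom x _).symm

theorem ncard_fiber [Finite F] (hz : z.localRing.valuation RatFunc.X ≤ 1)
    (hr : ∀ r, ¬ z.poly ∣ W.subst r) : (W.fiber z).ncard = 2 * z.degree := by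
  have hp := (ClosedPoint.poly_spec hz).2.1
  choose Y hY using exists_geomPoint (W := W)
  have hY' : ∀ (x : AlgebraicClosure F) (b : Bool),
      (bif b then Y x else -Polynomial.aeval x W.yCoeff - Y x) ^ 2 + Polynomial.aeval x W.yCoeff *
        (bif b then Y x else -Polynomial.aeval x W.yCoeff - Y x) +
        Polynomial.aeval x W.oneCoeff = 0 := by
    intro x b
    cases b
    · simp only [cond_false]; linear_combination hY x
    · exact hY x
  have hne : ∀ x : AlgebraicClosure F, Polynomial.aeval x z.poly = 0 →
      -Polynomial.aeval x W.yCoeff - Y x ≠ Y x := fun x hx e => by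
    obtain ⟨σ, -, h1, h2⟩ := exists_algEquiv_conj hp hr hx (hY x)
    exact h2 (h1.trans e)
  -- The Boolean labels the two distinct values of y over each of the `z.degree` roots x.
  have hcard : ({x : AlgebraicClosure F | Polynomial.aeval x z.poly = 0} ×ˢ
      (Set.univ : Set Bool)).ncard = 2 * z.degree := by
    rw [Set.ncard_prod, ncard_rootSet hz, Set.ncard_univ, Nat.card_eq_fintype_card,
      Fintype.card_bool, mul_comm]
  rw [← hcard]
  refine (Set.ncard_congr (fun xb _ => W.geomPoint xb.1
    (bif xb.2 then Y xb.1 else -Polynomial.aeval xb.1 W.yCoeff - Y xb.1) (hY' xb.1 xb.2))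
    ?_ ?_ ?_).symm
  · exact fun xb hxb => geomPoint_mem_fiber.2 ⟨hz, hxb.1⟩
  · rintro ⟨x, b⟩ ⟨x', b'⟩ hxb hxb' h
    obtain ⟨rfl, h⟩ := geomPoint_inj.1 h
    cases b <;> cases b'
    · rfl
    · exact absurd h (hne x hxb.1)
    · exact absurd h.symm (hne x hxb.1)
    · rfl
  · intro P hP
    rcases P.cases with rfl | ⟨x, y, h, rfl⟩
    · exact absurd (zero_mem_fiber.1 hP) (not_lt.2 hz)
    have hx := (geomPoint_mem_fiber.1 hP).2
    rcases eq_or_eq_of_equation (hY x) h with rfl | rfl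
    · exact ⟨(x, true), ⟨hx, Set.mem_univ _⟩, rfl⟩
    · exact ⟨(x, false), ⟨hx, Set.mem_univ _⟩, rfl⟩

end WeierstrassCurve
end

/-! ### The Euler product over the projective line. -/

noncomputable section

namespace WeierstrassCurve

open MulAction

variable {F : Type*} [Field F] {W : WeierstrassCurve F} {z : ClosedPoint F (RatFunc F)}

/-- The Galois orbits on the points of a Weierstrass curve over the algebraic closure. -/
abbrev GeomOrbit (W : WeierstrassCurve F) : Type _ :=
  orbitRel.Quotient (AlgebraicClosure F ≃ₐ[F] AlgebraicClosure F) W.GeomPoint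

theorem mk_eq_mk_iff {P Q : W.GeomPoint} : (Quotient.mk _ P : W.GeomOrbit) = Quotient.mk _ Q ↔
    P ∈ orbit (AlgebraicClosure F ≃ₐ[F] AlgebraicClosure F) Q :=
  Quotient.eq.trans orbitRel_apply

theorem dvd_trichotomy (W : WeierstrassCurve F) (p : F[X]) :
    (∃ r, p ∣ W.subst r ∧ p ∣ 2 * r + W.yCoeff) ∨ (∃ r, p ∣ W.subst r ∧ ¬ p ∣ 2 * r + W.yCoeff) ∨
      ∀ r, ¬ p ∣ W.subst r := by
  by_cases h : ∃ r, p ∣ W.subst r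
  · obtain ⟨r, hr⟩ := h
    by_cases h' : p ∣ 2 * r + W.yCoeff
    · exact Or.inl ⟨r, hr, h'⟩
    · exact Or.inr (Or.inl ⟨r, hr, h'⟩)
  · exact Or.inr (Or.inr (not_exists.1 h))

variable [W.IsElliptic]

/-- The orbits over a closed point of the projective line: they are finite in number, and the
product of their Euler factors is determined by the character of the double cover. -/
theorem exists_finset_orbits [Finite F] (W : WeierstrassCurve F) [W.IsElliptic]
    (z : ClosedPoint F (RatFunc F)) : ∃ T : Finset W.GeomOrbit,
      (∀ P : W.GeomPoint, Quotient.mk _ P ∈ T ↔ P ∈ W.fiber z) ∧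
      (∀ o ∈ T, z.degree ≤ o.orbit.ncard) ∧
      ∏ o ∈ T, eulerFactor o.orbit.ncard 1 =
        eulerFactor z.degree 1 * eulerFactor z.degree (z.chi W.toAffine.FunctionField) := by
  rcases lt_or_ge 1 (z.localRing.valuation RatFunc.X) with hz | hz
  · have horb : orbit (AlgebraicClosure F ≃ₐ[F] AlgebraicClosure F) (0 : W.GeomPoint) = {0} := by
      ext P
      constructor
      · rintro ⟨σ, rfl⟩; rfl
      · rintro rfl; exact mem_orbit_self _
    have hcard : (orbitRel.Quotient.orbit (Quotient.mk _ (0 : W.GeomPoint) : W.GeomOrbit)).ncard =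
        1 := by
      rw [orbitRel.Quotient.orbit_mk, horb, Set.ncard_singleton]
    refine ⟨{Quotient.mk _ 0}, fun P => ?_, ?_, ?_⟩
    · rw [Finset.mem_singleton, mk_eq_mk_iff, horb, Set.mem_singleton_iff]
      constructor
      · rintro rfl; exact zero_mem_fiber.2 hz
      · intro hP
        rcases P.cases with rfl | ⟨x, y, h, rfl⟩
        · rfl
        · exact absurd hz (not_lt.2 (geomPoint_mem_fiber.1 hP).1)
    · intro o ho
      rw [Finset.mem_singleton.1 ho, hcard, ClosedPoint.degree_eq_one_of_one_lt_valuation_X hz]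
    · rw [Finset.prod_singleton, hcard, ClosedPoint.degree_eq_one_of_one_lt_valuation_X hz,
        (W.isRamified_of_one_lt_valuation_X hz).chi_eq, eulerFactor_zero one_pos, mul_one]
  obtain ⟨-, hp, hzp⟩ := ClosedPoint.poly_spec hz
  have hpos := z.degree_pos
  -- Double root: one orbit of size d, χ = 0. Simple root: two orbits of size d, χ = 1. No root: one
  -- orbit of size 2d, χ = -1.
  rcases W.dvd_trichotomy z.poly with ⟨r, hr, hr'⟩ | ⟨r, hr, hr'⟩ | hr
  · obtain ⟨P, hP⟩ := nonempty_sheet hz hr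
    have horb := orbit_eq_sheet hz hP
    have hcard : (orbitRel.Quotient.orbit (Quotient.mk _ P : W.GeomOrbit)).ncard = z.degree := by
      rw [orbitRel.Quotient.orbit_mk, horb, ncard_sheet hz hr]
    refine ⟨{Quotient.mk _ P}, fun Q => ?_, ?_, ?_⟩
    · rw [Finset.mem_singleton, mk_eq_mk_iff, horb, fiber_eq_union_sheet hz hr,
        sheet_conj_eq hz hr', Set.union_self]
    · intro o ho
      rw [Finset.mem_singleton.1 ho, hcard]
    · rw [Finset.prod_singleton, hcard, (W.isRamified_of_dvd hzp hp hr hr').chi_eq,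
        eulerFactor_zero hpos, mul_one]
  · obtain ⟨P, hP⟩ := nonempty_sheet hz hr
    obtain ⟨Q, hQ⟩ := nonempty_sheet hz (dvd_subst_conj hr)
    have hP' := orbit_eq_sheet hz hP
    have hQ' := orbit_eq_sheet hz hQ
    have hPc : (orbitRel.Quotient.orbit (Quotient.mk _ P : W.GeomOrbit)).ncard = z.degree := by
      rw [orbitRel.Quotient.orbit_mk, hP', ncard_sheet hz hr]
    have hQc : (orbitRel.Quotient.orbit (Quotient.mk _ Q : W.GeomOrbit)).ncard = z.degree := by
      rw [orbitRel.Quotient.orbit_mk, hQ', ncard_sheet hz (dvd_subst_conj hr)]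
    have hne : (Quotient.mk _ P : W.GeomOrbit) ≠ Quotient.mk _ Q := by
      rw [Ne, mk_eq_mk_iff, hQ']
      exact Set.disjoint_left.1 (disjoint_sheet_conj hz hr') hP
    refine ⟨{Quotient.mk _ P, Quotient.mk _ Q}, fun R => ?_, ?_, ?_⟩
    · rw [Finset.mem_insert, Finset.mem_singleton, mk_eq_mk_iff, mk_eq_mk_iff, hP', hQ',
        fiber_eq_union_sheet hz hr, Set.mem_union]
    · intro o ho
      rcases Finset.mem_insert.1 ho with rfl | ho
      · exact hPc.ge
      · rw [Finset.mem_singleton.1 ho, hQc]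
    · rw [Finset.prod_pair hne, hPc, hQc, (W.isSplit_of_dvd hzp hp hr hr').chi_eq]
  · obtain ⟨x, hx⟩ := IsAlgClosed.exists_aeval_eq_zero (AlgebraicClosure F) z.poly
      (Polynomial.degree_pos_of_irreducible hp).ne'
    obtain ⟨y, hy⟩ := exists_geomPoint (W := W) x
    have hP : W.geomPoint x y hy ∈ W.fiber z := geomPoint_mem_fiber.2 ⟨hz, hx⟩
    set P := W.geomPoint x y hy
    have horb := orbit_eq_fiber hz hr hP
    have hcard : (orbitRel.Quotient.orbit (Quotient.mk _ P : W.GeomOrbit)).ncard =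
        2 * z.degree := by
      rw [orbitRel.Quotient.orbit_mk, horb, ncard_fiber hz hr]
    refine ⟨{Quotient.mk _ P}, fun Q => ?_, ?_, ?_⟩
    · rw [Finset.mem_singleton, mk_eq_mk_iff, horb]
    · intro o ho
      rw [Finset.mem_singleton.1 ho, hcard]
      omega
    · rw [Finset.prod_singleton, hcard, (W.isInert_of_forall_not_dvd hzp hp hr).chi_eq
        (W.not_isSplit_of_forall_not_dvd hzp hp hr), eulerFactor_two_mul hpos]

variable (W) [Finite F]

/-- The finite set of orbits over a closed point of the projective line. -/
def orbitsOver (z : ClosedPoint F (RatFunc F)) : Finset W.GeomOrbit :=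
  (W.exists_finset_orbits z).choose

theorem mk_mem_orbitsOver {P : W.GeomPoint} : Quotient.mk _ P ∈ W.orbitsOver z ↔ P ∈ W.fiber z :=
  (W.exists_finset_orbits z).choose_spec.1 P

theorem degree_le_ncard_orbit {o : W.GeomOrbit} (ho : o ∈ W.orbitsOver z) :
    z.degree ≤ o.orbit.ncard :=
  (W.exists_finset_orbits z).choose_spec.2.1 o ho

theorem prod_orbitsOver (z : ClosedPoint F (RatFunc F)) :
    ∏ o ∈ W.orbitsOver z, eulerFactor o.orbit.ncard 1 =
      eulerFactor z.degree 1 * eulerFactor z.degree (z.chi W.toAffine.FunctionField) :=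
  (W.exists_finset_orbits z).choose_spec.2.2

theorem exists_mem_orbitsOver (o : W.GeomOrbit) : ∃ z, o ∈ W.orbitsOver z := by
  obtain ⟨P, rfl⟩ := Quotient.exists_rep o
  obtain ⟨z, hz⟩ := exists_mem_fiber P
  exact ⟨z, W.mk_mem_orbitsOver.2 hz⟩

theorem disjoint_orbitsOver {z z' : ClosedPoint F (RatFunc F)} (h : z ≠ z') :
    Disjoint (W.orbitsOver z) (W.orbitsOver z') := by
  rw [Finset.disjoint_left]
  intro o ho ho'
  obtain ⟨P, rfl⟩ := Quotient.exists_rep o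
  exact h (eq_of_mem_fiber (W.mk_mem_orbitsOver.1 ho) (W.mk_mem_orbitsOver.1 ho'))

theorem ncard_orbit_pos (o : W.GeomOrbit) : 0 < o.orbit.ncard := by
  obtain ⟨z, hz⟩ := W.exists_mem_orbitsOver o
  exact z.degree_pos.trans_le (W.degree_le_ncard_orbit hz)

/-- `Set.ncard` is 0 on infinite sets, so positive cardinality already gives finiteness. -/
theorem finite_orbit (o : W.GeomOrbit) : o.orbit.Finite :=
  Set.finite_of_ncard_pos (W.ncard_orbit_pos o)

/-- The closed points of the projective line of bounded degree. -/
def boundedPoints (F : Type*) [Field F] [Finite F] (n : ℕ) :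
    Finset (ClosedPoint F (RatFunc F)) :=
  (ClosedPoint.finite_setOf_degree_le n).toFinset

theorem mem_boundedPoints {n : ℕ} : z ∈ boundedPoints F n ↔ z.degree ≤ n :=
  Set.Finite.mem_toFinset _

/-- The orbits over the closed points of the projective line of bounded degree. -/
def boundedOrbits (n : ℕ) : Finset W.GeomOrbit :=
  (boundedPoints F n).biUnion W.orbitsOver

theorem mem_boundedOrbits {n : ℕ} (o : W.GeomOrbit) (ho : o.orbit.ncard ≤ n) :
    o ∈ W.boundedOrbits n := by
  obtain ⟨z, hz⟩ := W.exists_mem_orbitsOver o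
  exact Finset.mem_biUnion.2
    ⟨z, mem_boundedPoints.2 ((W.degree_le_ncard_orbit hz).trans ho), hz⟩

/-- A truncated form of Z(E,T) = Z(P^1,T) L(χ,T). Whole fibres are taken so that the factors can be
grouped; orbits with more than n points may occur, but do not affect coefficients up to n. -/
theorem prod_boundedOrbits (n : ℕ) :
    ∏ o ∈ W.boundedOrbits n, eulerFactor o.orbit.ncard 1 =
      (∏ z ∈ boundedPoints F n, eulerFactor z.degree 1) *
        ∏ z ∈ boundedPoints F n, eulerFactor z.degree (z.chi W.toAffine.FunctionField) := by
  rw [boundedOrbits, Finset.prod_biUnion fun z _ z' _ h => W.disjoint_orbitsOver h,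
    ← Finset.prod_mul_distrib]
  exact Finset.prod_congr rfl fun z _ => W.prod_orbitsOver z

/-- The stable multisets of points as formal sums of orbits. -/
def symPointEquiv (n : ℕ) :
    {α : W.GeomOrbit →₀ ℕ | (α.sum fun o a => a * o.orbit.ncard) = n} ≃ W.SymPoint n :=
  symStableEquiv W.finite_orbit n

theorem finite_symPoint (n : ℕ) : Finite (W.SymPoint n) :=
  have : Finite {α : W.GeomOrbit →₀ ℕ | (α.sum fun o a => a * o.orbit.ncard) = n} :=
    finite_setOf_sum_eq W.ncard_orbit_pos (S := W.boundedOrbits n) W.mem_boundedOrbits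
  Finite.of_equiv _ (W.symPointEquiv n)

theorem finite_setOf_degree_eq (n : ℕ) :
    {α : EffectiveCycle F (RatFunc F) | α.degree = n}.Finite :=
  finite_setOf_sum_eq ClosedPoint.degree_pos (S := boundedPoints F n)
    fun _ h => mem_boundedPoints.2 h

theorem card_symPoint (n : ℕ) : (Nat.card (W.SymPoint n) : ℤ) =
    ∑ ij ∈ Finset.HasAntidiagonal.antidiagonal n,
      (∑ l ∈ Finset.range (ij.1 + 1), (Nat.card F : ℤ) ^ l) *
        ∑ᶠ α ∈ {α : EffectiveCycle F (RatFunc F) | α.degree = ij.2},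
          α.chi W.toAffine.FunctionField := by
  rw [← Nat.card_congr (W.symPointEquiv n), card_eq_coeff_prod_eulerFactor W.ncard_orbit_pos
    (S := W.boundedOrbits n) W.mem_boundedOrbits, prod_boundedOrbits, PowerSeries.coeff_mul]
  refine Finset.sum_congr rfl fun ij hij => ?_
  replace hij := Finset.HasAntidiagonal.mem_antidiagonal.1 hij
  congr 1
  · rw [← card_eq_coeff_prod_eulerFactor ClosedPoint.degree_pos
      (fun z hz => mem_boundedPoints.2 (hz.trans (by omega)))]
    have := EffectiveCycle.card_degree_eq (F := F) ij.1
    exact_mod_cast this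
  · exact (finsum_eq_coeff_prod_eulerFactor _ ClosedPoint.degree_pos
      fun z hz => mem_boundedPoints.2 (hz.trans (by omega))).symm

end WeierstrassCurve
end

/-! ### Rational points and the trace. -/

noncomputable section

variable {F : Type*} [Field F]

namespace ClosedPoint

theorem chi_eq_sub (W : WeierstrassCurve F) [W.IsElliptic] (x : ClosedPoint F (RatFunc F)) :
    x.chi W.toAffine.FunctionField = (if x.IsSplit W.toAffine.FunctionField then 1 else 0) -
      (if x.IsInert W.toAffine.FunctionField then 1 else 0) := by
  -- Without this exclusivity a point could be counted in both indicators while `chi` gives it the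
  -- value 1.
  have key : x.IsSplit W.toAffine.FunctionField → ¬ x.IsInert W.toAffine.FunctionField := by
    intro hs hi
    rcases le_or_gt (x.localRing.valuation RatFunc.X) 1 with hX | hX
    · obtain ⟨-, hp, hx⟩ := poly_spec hX
      rcases W.dvd_trichotomy x.poly with ⟨r, hr, hr'⟩ | ⟨r, hr, hr'⟩ | hr
      · exact hi.1 (W.isRamified_of_dvd hx hp hr hr')
      · exact W.not_isInert_of_dvd hx hp hr hr' hi
      · exact W.not_isSplit_of_forall_not_dvd hx hp hr hs
    · exact hi.1 (W.isRamified_of_one_lt_valuation_X hX)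
  by_cases hr : x.IsRamified W.toAffine.FunctionField
  · rw [hr.chi_eq, if_neg fun h => h.not_isRamified hr, if_neg fun h => h.1 hr, sub_zero]
  · by_cases hs : x.IsSplit W.toAffine.FunctionField
    · rw [hs.chi_eq, if_pos hs, if_neg (key hs), sub_zero]
    · rw [chi, if_neg hr, if_neg hs, if_neg hs]
      split_ifs <;> simp

theorem exists_isZeroOf_X_sub_C (a : F) :
    ∃ x : ClosedPoint F (RatFunc F), x.IsZeroOf (Polynomial.X - Polynomial.C a) :=
  exists_isZeroOf (Polynomial.irreducible_X_sub_C a)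

/-- The rational point of the affine line with coordinate `a`. -/
def ofCoord (a : F) : ClosedPoint F (RatFunc F) := (exists_isZeroOf_X_sub_C a).choose

theorem isZeroOf_ofCoord (a : F) : (ofCoord a).IsZeroOf (Polynomial.X - Polynomial.C a) :=
  (exists_isZeroOf_X_sub_C a).choose_spec

theorem poly_ofCoord (a : F) : (ofCoord a).poly = Polynomial.X - Polynomial.C a :=
  (isZeroOf_ofCoord a).poly_eq (Polynomial.irreducible_X_sub_C a) (Polynomial.monic_X_sub_C a)

theorem ofCoord_injective : Function.Injective (ofCoord (F := F)) := fun a b h => by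
  have := congrArg poly h
  rw [poly_ofCoord, poly_ofCoord] at this
  exact Polynomial.C_injective (sub_right_injective this)

theorem setOf_degree_eq_one {z : ClosedPoint F (RatFunc F)}
    (hz : 1 < z.localRing.valuation RatFunc.X) :
    {x : ClosedPoint F (RatFunc F) | x.degree = 1} = insert z (Set.range ofCoord) := by
  ext x
  constructor
  · intro hx
    rcases le_or_gt (x.localRing.valuation RatFunc.X) 1 with hX | hX
    · obtain ⟨hm, -, -⟩ := poly_spec hX
      have hd : x.poly.natDegree = 1 := (degree_eq_natDegree_poly hX).symm.trans hx
      -- A monic linear polynomial X + c vanishes at the coordinate -c.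
      refine Or.inr ⟨-x.poly.coeff 0, poly_injective ?_⟩
      rw [poly_ofCoord, map_neg, sub_neg_eq_add]
      exact (hm.eq_X_add_C hd).symm
    · exact Or.inl (eq_of_one_lt_valuation_X hX hz)
  · rintro (rfl | ⟨a, rfl⟩)
    · exact degree_eq_one_of_one_lt_valuation_X hz
    · exact ((isZeroOf_ofCoord a).degree_eq (Polynomial.irreducible_X_sub_C a)).trans
        (Polynomial.natDegree_X_sub_C a)

theorem finite_setOf_degree_eq_one [Finite F] :
    {x : ClosedPoint F (RatFunc F) | x.degree = 1}.Finite :=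
  (finite_setOf_degree_le 1).subset fun _ hx => le_of_eq hx

end ClosedPoint

namespace WeierstrassCurve

open ClosedPoint

variable (W : WeierstrassCurve F)

theorem finsum_chi_eq_sum [Fintype F] [W.IsElliptic] :
    ∑ᶠ x ∈ {x : ClosedPoint F (RatFunc F) | x.degree = 1}, x.chi W.toAffine.FunctionField =
      ∑ a : F, (ofCoord a).chi W.toAffine.FunctionField := by
  obtain ⟨z, hz⟩ := exists_one_lt_valuation_X (F := F)
  rw [setOf_degree_eq_one hz, finsum_mem_insert_zero
    (W.isRamified_of_one_lt_valuation_X hz).chi_eq, finsum_mem_range ofCoord_injective,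
    finsum_eq_sum_of_fintype]

theorem finsum_chi_eq_sub [Finite F] [W.IsElliptic] :
    ∑ᶠ x ∈ {x : ClosedPoint F (RatFunc F) | x.degree = 1}, x.chi W.toAffine.FunctionField =
      (W.splitCount : ℤ) - (W.inertCount : ℤ) := by
  have hfin := finite_setOf_degree_eq_one (F := F)
  have hcount (p : ClosedPoint F (RatFunc F) → Prop) :
      ∑ x ∈ hfin.toFinset, (if p x then 1 else 0 : ℤ) =
        ({x : ClosedPoint F (RatFunc F) | x.degree = 1 ∧ p x}.ncard : ℤ) := by
    rw [Finset.sum_boole, ← Set.ncard_coe_finset]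
    congr 2
    ext x
    simp
  rw [finsum_mem_eq_finite_toFinset_sum _ hfin,
    Finset.sum_congr rfl fun x _ => x.chi_eq_sub W, Finset.sum_sub_distrib, hcount, hcount]
  rfl

theorem equation_iff_eval (a y : F) : W.toAffine.Equation a y ↔
    y ^ 2 + W.yCoeff.eval a * y + W.oneCoeff.eval a = 0 := by
  rw [Affine.equation_iff', yCoeff, oneCoeff]
  simp only [Polynomial.eval_add, Polynomial.eval_mul, Polynomial.eval_C, Polynomial.eval_X,
    Polynomial.eval_neg, Polynomial.eval_pow]
  constructor <;> intro h <;> linear_combination h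

theorem eval_subst (a : F) (r : F[X]) : (W.subst r).eval a =
    r.eval a ^ 2 + W.yCoeff.eval a * r.eval a + W.oneCoeff.eval a := by
  simp [subst]

/-- Modulo X - a the trichotomy concerns roots in F itself: one, two or no values of y, with χ = 0,
1, -1. -/
theorem ncard_equation [W.IsElliptic] (a : F) :
    ({y : F | W.toAffine.Equation a y}.ncard : ℤ) =
      (ofCoord a).chi W.toAffine.FunctionField + 1 := by
  have hp := Polynomial.irreducible_X_sub_C a
  have hx := isZeroOf_ofCoord a
  have hset {r : F[X]} (hr : Polynomial.X - Polynomial.C a ∣ W.subst r) :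
      {y : F | W.toAffine.Equation a y} = {r.eval a, -W.yCoeff.eval a - r.eval a} := by
    rw [Polynomial.dvd_iff_isRoot, Polynomial.IsRoot.def, eval_subst] at hr
    ext y
    simp only [Set.mem_ofPred_eq, equation_iff_eval, Set.mem_insert_iff, Set.mem_singleton_iff]
    constructor
    · exact fun hy => eq_or_eq_of_equation hr hy
    · rintro (rfl | rfl)
      · exact hr
      · linear_combination hr
  have hdiff (r : F[X]) : Polynomial.X - Polynomial.C a ∣ 2 * r + W.yCoeff ↔
      r.eval a = -W.yCoeff.eval a - r.eval a := by
    rw [Polynomial.dvd_iff_isRoot, Polynomial.IsRoot.def, Polynomial.eval_add, Polynomial.eval_mul,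
      Polynomial.eval_ofNat]
    constructor <;> intro h <;> linear_combination h
  rcases W.dvd_trichotomy (Polynomial.X - Polynomial.C a) with ⟨r, hr, hr'⟩ | ⟨r, hr, hr'⟩ | hr
  · rw [(W.isRamified_of_dvd hx hp hr hr').chi_eq, hset hr, ← (hdiff r).1 hr',
      Set.pair_eq_singleton,
      Set.ncard_singleton]
    rfl
  · rw [(W.isSplit_of_dvd hx hp hr hr').chi_eq, hset hr, Set.ncard_pair (mt (hdiff r).2 hr')]
    rfl
  · rw [(W.isInert_of_forall_not_dvd hx hp hr).chi_eq (W.not_isSplit_of_forall_not_dvd hx hp hr),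
      show {y : F | W.toAffine.Equation a y} = ∅ from ?_, Set.ncard_empty]
    · rfl
    · refine Set.eq_empty_of_forall_notMem fun y hy => hr (Polynomial.C y) ?_
      rw [Polynomial.dvd_iff_isRoot, Polynomial.IsRoot.def, eval_subst, Polynomial.eval_C]
      exact (W.equation_iff_eval a y).1 hy

/-- The points of an elliptic curve, sorted by their first coordinate. -/
def pointEquivSigma [W.IsElliptic] :
    W.toAffine.Point ≃ Option ((a : F) × {y : F | W.toAffine.Equation a y}) :=
  (Affine.pointEquiv W.toAffine).trans
    (Equiv.optionCongr (Equiv.subtypeProdEquivSigmaSubtype fun a y => W.toAffine.Equation a y))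

theorem finite_point [Finite F] [W.IsElliptic] : Finite W.toAffine.Point :=
  Finite.of_equiv _ W.pointEquivSigma.symm

theorem card_point [Fintype F] [W.IsElliptic] : (Nat.card W.toAffine.Point : ℤ) =
    Nat.card F + 1 + ∑ a : F, (ofCoord a).chi W.toAffine.FunctionField := by
  rw [Nat.card_congr W.pointEquivSigma, Finite.card_option, Nat.card_sigma]
  push_cast
  rw [Finset.sum_congr rfl fun a _ => by rw [Nat.card_coe_set_eq, W.ncard_equation a],
    Finset.sum_add_distrib,
    Finset.sum_const, Finset.card_univ, Nat.card_eq_fintype_card]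
  simp only [nsmul_eq_mul, mul_one]
  ring

theorem aq_eq_neg_finsum_chi [Finite F] [W.IsElliptic] :
    W.aq = - ∑ᶠ x ∈ {x : ClosedPoint F (RatFunc F) | x.degree = 1},
      x.chi W.toAffine.FunctionField := by
  have := Fintype.ofFinite F
  rw [finsum_chi_eq_sum, aq, card_point]
  ring

end WeierstrassCurve
end

theorem mainTheorem3 {F : Type*} [Field F] [Finite F] (W : WeierstrassCurve F) [W.IsElliptic] :
    -- the point sets and sums below are finite
    Finite W.toAffine.Point ∧
    (∀ n : ℕ, {α : EffectiveCycle F (RatFunc F) | α.degree = n}.Finite) ∧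
    {x : ClosedPoint F (RatFunc F) | x.degree = 1}.Finite ∧
    (∀ n : ℕ, Finite (W.SymPoint n)) ∧
    -- the trace as the sum of the character over the rational points of the projective line
    W.aq = - ∑ᶠ x ∈ {x : ClosedPoint F (RatFunc F) | x.degree = 1},
      x.chi W.toAffine.FunctionField ∧
    W.aq = (W.inertCount : ℤ) - (W.splitCount : ℤ) ∧
    -- the number of points of the symmetric powers
    ∀ n : ℕ, (Nat.card (W.SymPoint n) : ℤ) =
      ∑ ij ∈ Finset.HasAntidiagonal.antidiagonal n, (∑ l ∈ Finset.range (ij.1 + 1), (Nat.card F : ℤ) ^ l) *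
        ∑ᶠ α ∈ {α : EffectiveCycle F (RatFunc F) | α.degree = ij.2},
          α.chi W.toAffine.FunctionField := by
  refine ⟨W.finite_point, WeierstrassCurve.finite_setOf_degree_eq,
    ClosedPoint.finite_setOf_degree_eq_one, W.finite_symPoint, W.aq_eq_neg_finsum_chi, ?_,
    W.card_symPoint⟩
  rw [W.aq_eq_neg_finsum_chi, W.finsum_chi_eq_sub, neg_sub]
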